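/- Let $\mathbb T\subseteq\mathbb R$ be an open (possibly unbounded) interval, and let $A\in L^1_{\rm loc}(\mathbb T,\mathbb C^{n,n})$, $B\in L^2_{\rm loc}(\mathbb T,\mathbb C^{n,m})$, $C\in L^2_{\rm loc}(\mathbb T,\mathbb C^{m,n})$, $D\in L^\infty_{\rm loc}(\mathbb T,\mathbb C^{m,m})$. Consider the linear time-varying system $$\dot x=A(t)x+B(t)u,\qquad y=C(t)x+D(t)u .\tag{1}$$ A state-input-output solution of (1) is a triple $(x,u,y)$ with $x\in W^{1,1}_{\rm loc}(\mathbb T,\mathbb C^n)$ (identified with its continuous representative) and $u,y\in L^2_{\rm loc}(\mathbb T,\mathbb C^m)$ that satisfies (1) almost everywhere on $\mathbb T$, with $\dot x$ the weak derivative. A storage function for (1) is a function $V:\mathbb T\times\mathbb C^n\to[0,\infty)$ such that $V(t,0)=0$ for all $t\in\mathbb T$ and $$V(t_1,x(t_1))-V(t_0,x(t_0))\le\int_{t_0}^{t_1}\operatorname{Re}\bigl(y(t)^{\mathsf H}u(t)\bigr)\,dt$$ for all $t_0,t_1\in\mathbb T$ with $t_0\le t_1$ and all state-input-output solutions $(x,u,y)$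 of (1). Let $Q:\mathbb T\to\mathbb C^{n,n}$ be of locally bounded variation (of finite total variation on every $[t_0,t_1]\subseteq\mathbb T$) with $Q(t)$ Hermitian positive semidefinite for every $t\in\mathbb T$. Then $V_Q(t,x)=\tfrac12x^{\mathsf H}Q(t)x$ is a storage function for (1) if and only if $Q$ satisfies the integral KYP inequality, i.e., the matrix $$\begin{bmatrix}-\displaystyle\int_{t_0}^{t_1}\bigl(A(t)^{\mathsf H}Q(t)+Q(t)A(t)\bigr)dt+Q(t_0)-Q(t_1)&\displaystyle\int_{t_0}^{t_1}\bigl(C(t)^{\mathsf H}-Q(t)B(t)\bigr)dt\\[2mm]\displaystyle\int_{t_0}^{t_1}\bigl(C(t)-B(t)^{\mathsf H}Q(t)\bigr)dt&\displaystyle\int_{t_0}^{t_1}\bigl(D(t)+D(t)^{\mathsf H}\bigr)dt\end{bmatrix}$$ is Hermitian positive semidefinite for all $t_0,t_1\in\mathbb T$ with $t_0\le t_1$. -/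

import Mathlib

open MeasureTheory
open scoped Matrix ContDiff ComplexOrder

noncomputable section

namespace LTV

/-- `f ∈ L^p_loc(T, ℂ)`: the restriction of `f` to every compact subset of `T` is in `L^p`. -/
def MemLpLoc (T : Set ℝ) (p : ENNReal) (f : ℝ → ℂ) : Prop :=
  ∀ K : Set ℝ, K ⊆ T → IsCompact K → MemLp f p (volume.restrict K)

/-- `f ∈ L^p_loc(T, ℂⁿ)`: every component is in `L^p_loc(T, ℂ)`. -/
def VecMemLpLoc {n : ℕ} (T : Set ℝ) (p : ENNReal) (f : ℝ → Fin n → ℂ) : Prop :=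
  ∀ i, MemLpLoc T p (fun t => f t i)

/-- `F ∈ L^p_loc(T, ℂ^{m,n})`: every entry is in `L^p_loc(T, ℂ)`. -/
def MatMemLpLoc {m n : ℕ} (T : Set ℝ) (p : ENNReal)
    (F : ℝ → Matrix (Fin m) (Fin n) ℂ) : Prop :=
  ∀ i j, MemLpLoc T p (fun t => F t i j)

/-- `F ∈ BV_loc(T, ℂ^{n,n})`: on every `[t₀, t₁] ⊆ T` the matrix function `F` has finite total
variation with respect to the induced 2-norm, which is the norm of the operator
`Matrix.toEuclideanCLM (F t)` on the Euclidean space `ℂⁿ`. -/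
def MatBVLoc {n : ℕ} (T : Set ℝ) (F : ℝ → Matrix (Fin n) (Fin n) ℂ) : Prop :=
  LocallyBoundedVariationOn
    (fun t => Matrix.toEuclideanCLM (n := Fin n) (𝕜 := ℂ) (F t)) T

/-- `g ∈ L^1_loc(T, ℂⁿ)` is the weak derivative on the open set `T` of `f ∈ L^1_loc(T, ℂⁿ)`. -/
def HasWeakDeriv {n : ℕ} (T : Set ℝ) (f g : ℝ → Fin n → ℂ) : Prop :=
  VecMemLpLoc T 1 f ∧ VecMemLpLoc T 1 g ∧
    ∀ φ : ℝ → ℝ, ContDiff ℝ ∞ φ → HasCompactSupport φ → tsupport φ ⊆ T →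
      ∀ i, ∫ t in T, ((deriv φ t : ℝ) : ℂ) * f t i = - ∫ t in T, ((φ t : ℝ) : ℂ) * g t i

/-- `f ∈ W^{1,1}_loc(T, ℂⁿ)`. -/
def MemW11Loc {n : ℕ} (T : Set ℝ) (f : ℝ → Fin n → ℂ) : Prop :=
  ∃ g, HasWeakDeriv T f g

/-- A linear time-varying system on `T` with state dimension `n` and input/output dimension `m`:
`ẋ = A x + B u`, `y = C x + D u`. -/
structure System (T : Set ℝ) (n m : ℕ) where
  A : ℝ → Matrix (Fin n) (Fin n) ℂ
  B : ℝ → Matrix (Fin n) (Fin m) ℂ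
  C : ℝ → Matrix (Fin m) (Fin n) ℂ
  D : ℝ → Matrix (Fin m) (Fin m) ℂ
  memA : MatMemLpLoc T 1 A
  memB : MatMemLpLoc T 2 B
  memC : MatMemLpLoc T 2 C
  memD : MatMemLpLoc T ⊤ D

variable {T : Set ℝ} {n m : ℕ}

/-- State-input-output solutions of the system. The state is given by its continuous
representative, so that its point values are meaningful; the state equation holds with the weak
derivative, the output equation almost everywhere. -/
structure IsSolution (S : System T n m) (x : ℝ → Fin n → ℂ) (u y : ℝ → Fin m → ℂ) : Prop where
  continuousOn : ContinuousOn x T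
  memState : MemW11Loc T x
  memInput : VecMemLpLoc T 2 u
  memOutput : VecMemLpLoc T 2 y
  state_eq : HasWeakDeriv T x (fun t => S.A t *ᵥ x t + S.B t *ᵥ u t)
  output_eq : ∀ᵐ t ∂(volume.restrict T), y t = S.C t *ᵥ x t + S.D t *ᵥ u t

/-- Storage functions of the system. -/
structure IsStorageFunction (S : System T n m) (V : ℝ → (Fin n → ℂ) → ℝ) : Prop where
  nonneg : ∀ t ∈ T, ∀ x, 0 ≤ V t x
  zero : ∀ t ∈ T, V t 0 = 0
  dissipation : ∀ (x : ℝ → Fin n → ℂ) (u y : ℝ → Fin m → ℂ), IsSolution S x u y →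
    ∀ t₀ ∈ T, ∀ t₁ ∈ T, t₀ ≤ t₁ →
      V t₁ (x t₁) - V t₀ (x t₀) ≤ ∫ t in t₀..t₁, (star (y t) ⬝ᵥ u t).re

/-- The quadratic function `(t, x) ↦ ½ xᴴ Q(t) x`, real-valued for Hermitian `Q(t)`. -/
def quadFun (Q : ℝ → Matrix (Fin n) (Fin n) ℂ) (t : ℝ) (x : Fin n → ℂ) : ℝ :=
  1 / 2 * (star x ⬝ᵥ (Q t *ᵥ x)).re

/-- The entrywise integral of a matrix function over `[t₀, t₁]`. -/
def matIntegral {p q : ℕ} (F : ℝ → Matrix (Fin p) (Fin q) ℂ) (t₀ t₁ : ℝ) :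
    Matrix (Fin p) (Fin q) ℂ :=
  Matrix.of fun i j => ∫ t in t₀..t₁, F t i j

/-- The block matrix of the integral KYP inequality on `[t₀, t₁]`. -/
def kypMatrix (S : System T n m) (Q : ℝ → Matrix (Fin n) (Fin n) ℂ) (t₀ t₁ : ℝ) :
    Matrix (Fin n ⊕ Fin m) (Fin n ⊕ Fin m) ℂ :=
  Matrix.fromBlocks
    (-matIntegral (fun t => (S.A t)ᴴ * Q t + Q t * S.A t) t₀ t₁ + Q t₀ - Q t₁)
    (matIntegral (fun t => (S.C t)ᴴ - Q t * S.B t) t₀ t₁)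
    (matIntegral (fun t => S.C t - (S.B t)ᴴ * Q t) t₀ t₁)
    (matIntegral (fun t => S.D t + (S.D t)ᴴ) t₀ t₁)

/-- `Q` satisfies the integral KYP inequality. -/
def IntegralKYP (S : System T n m) (Q : ℝ → Matrix (Fin n) (Fin n) ℂ) : Prop :=
  ∀ t₀ ∈ T, ∀ t₁ ∈ T, t₀ ≤ t₁ → (kypMatrix S Q t₀ t₁).PosSemidef

end LTV

end

/-! Write `M(t)` for `kypIntegrand` and `z = (x, u)`. Expanding gives `2 Re xᴴQ(Ax + Bu) + zᴴMz = 2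
Re yᴴu` (`sesq_kypIntegrand`), so twice the dissipation inequality says that `xᴴQx` at the left end
minus `xᴴQx` at the right end, plus the integral of `2 Re xᴴQẋ + zᴴMz`, is nonnegative along
solutions. The integral KYP inequality says the same with `z` frozen at a constant `(ξ, η)` and `ẋ`
replaced by `0` (`integralKYP_iff`).

Since `Q` is only of bounded variation and may jump, `xᴴQx` cannot be differentiated. Instead the
two expressions are compared on short intervals `[s, s']`. If `x` and the input move by at most `ε`
there and the integral of a bound for `‖ẋ‖` is at most `ε`, the expressions differ by at most `ε
(w(s') - w(s))`, where `w` combines the variation of `Q`, the integrated bound for `‖ẋ‖` and the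
integral of `‖M‖` (`abs_local_difference_le`). A jump of `Q` is not small, but it is multiplied by
the small integral of `‖ẋ‖`. Both expressions are increments of functions of time, so errors over a
fine partition add up to `ε` times a fixed number, and `le_of_local_increment` removes them.

From storage to KYP: on each short interval start a new solution at `ξ` with constant input `η`;
dissipation on it gives the frozen inequality up to the error. This requires global Carathéodory
solutions, obtained from a Neumann series (`exists_linear_ode_solution`). From KYP to storage: apply
KYP at the frozen values of the trajectory. This requires a continuous input in the quadratic form,
so `u` is replaced there, and only there, by a continuous `v` close to it in `L²`, and the change is
estimated by `kypIntegrand_perturbation_le`. `hasWeakDeriv_iff` translates weak derivatives into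
integral equations. -/

namespace LTV

/-! ### The real part of a sesquilinear form -/

section Sesq

variable {ι κ : Type*} [Fintype ι] [Fintype κ]

/-- The real part of the sesquilinear form `xᴴ M y`. -/
noncomputable def sesq (M : Matrix ι κ ℂ) (x : ι → ℂ) (y : κ → ℂ) : ℝ := (star x ⬝ᵥ M *ᵥ y).re

theorem sesq_add_matrix (M N : Matrix ι κ ℂ) (x : ι → ℂ) (y : κ → ℂ) :
    sesq (M + N) x y = sesq M x y + sesq N x y := by
  simp [sesq, Matrix.add_mulVec, dotProduct_add]

theorem sesq_sub_matrix (M N : Matrix ι κ ℂ) (x : ι → ℂ) (y : κ → ℂ) :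
    sesq (M - N) x y = sesq M x y - sesq N x y := by
  simp [sesq, Matrix.sub_mulVec, dotProduct_sub]

theorem sesq_neg_matrix (M : Matrix ι κ ℂ) (x : ι → ℂ) (y : κ → ℂ) :
    sesq (-M) x y = -sesq M x y := by
  simp [sesq, Matrix.neg_mulVec]

theorem sesq_add_left (M : Matrix ι κ ℂ) (x x' : ι → ℂ) (y : κ → ℂ) :
    sesq M (x + x') y = sesq M x y + sesq M x' y := by
  simp [sesq, add_dotProduct]

theorem sesq_sub_left (M : Matrix ι κ ℂ) (x x' : ι → ℂ) (y : κ → ℂ) :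
    sesq M (x - x') y = sesq M x y - sesq M x' y := by
  simp [sesq, sub_dotProduct]

theorem sesq_add_right (M : Matrix ι κ ℂ) (x : ι → ℂ) (y y' : κ → ℂ) :
    sesq M x (y + y') = sesq M x y + sesq M x y' := by
  simp [sesq, Matrix.mulVec_add, dotProduct_add]

theorem sesq_sub_right (M : Matrix ι κ ℂ) (x : ι → ℂ) (y y' : κ → ℂ) :
    sesq M x (y - y') = sesq M x y - sesq M x y' := by
  simp [sesq, Matrix.mulVec_sub, dotProduct_sub]

theorem sesq_conjTranspose (M : Matrix ι κ ℂ) (x : ι → ℂ) (y : κ → ℂ) :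
    sesq Mᴴ y x = sesq M x y := by
  have h : star y ⬝ᵥ Mᴴ *ᵥ x = star (star x ⬝ᵥ M *ᵥ y) := by
    rw [Matrix.star_dotProduct, Matrix.star_mulVec, Matrix.conjTranspose_conjTranspose,
      ← Matrix.dotProduct_mulVec]
  simp only [sesq, h]
  simp

theorem sesq_comm_of_isHermitian {M : Matrix ι ι ℂ} (hM : M.IsHermitian) (x y : ι → ℂ) :
    sesq M x y = sesq M y x := by
  conv_lhs => rw [← hM.eq]
  exact sesq_conjTranspose M y x

theorem sesq_eq_sum (M : Matrix ι κ ℂ) (x : ι → ℂ) (y : κ → ℂ) :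
    sesq M x y = ∑ i, ∑ j, (star (x i) * (M i j * y j)).re := by
  simp only [sesq, dotProduct, Matrix.mulVec, Finset.mul_sum, Complex.re_sum, Pi.star_apply]

/-- The sum of the absolute values of the entries of a matrix. -/
noncomputable def entryNorm (M : Matrix ι κ ℂ) : ℝ := ∑ i, ∑ j, ‖M i j‖

theorem entryNorm_nonneg (M : Matrix ι κ ℂ) : 0 ≤ entryNorm M :=
  Finset.sum_nonneg fun _ _ => Finset.sum_nonneg fun _ _ => norm_nonneg _

theorem norm_entry_le (M : Matrix ι κ ℂ) (i : ι) (j : κ) : ‖M i j‖ ≤ entryNorm M :=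
  (Finset.single_le_sum (f := fun j => ‖M i j‖) (fun _ _ => norm_nonneg _)
    (Finset.mem_univ j)).trans
    (Finset.single_le_sum (f := fun i => ∑ j, ‖M i j‖)
      (fun _ _ => Finset.sum_nonneg fun _ _ => norm_nonneg _) (Finset.mem_univ i))

theorem norm_mulVec_le (M : Matrix ι κ ℂ) (y : κ → ℂ) : ‖M *ᵥ y‖ ≤ entryNorm M * ‖y‖ := by
  refine (pi_norm_le_iff_of_nonneg (mul_nonneg (entryNorm_nonneg M) (norm_nonneg y))).2 fun i => ?_
  have h : ‖(M *ᵥ y) i‖ ≤ ∑ j, ‖M i j‖ * ‖y‖ := by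
    refine (norm_sum_le _ _).trans (Finset.sum_le_sum fun j _ => ?_)
    rw [norm_mul]
    gcongr
    exact norm_le_pi_norm y j
  rw [← Finset.sum_mul] at h
  refine h.trans ?_
  gcongr
  exact Finset.single_le_sum (f := fun i => ∑ j, ‖M i j‖)
    (fun _ _ => Finset.sum_nonneg fun _ _ => norm_nonneg _) (Finset.mem_univ i)

theorem abs_sesq_le (M : Matrix ι κ ℂ) (x : ι → ℂ) (y : κ → ℂ) :
    |sesq M x y| ≤ entryNorm M * (‖x‖ * ‖y‖) := by
  rw [sesq_eq_sum, entryNorm, Finset.sum_mul]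
  refine (Finset.abs_sum_le_sum_abs _ _).trans (Finset.sum_le_sum fun i _ => ?_)
  rw [Finset.sum_mul]
  refine (Finset.abs_sum_le_sum_abs _ _).trans (Finset.sum_le_sum fun j _ => ?_)
  refine (Complex.abs_re_le_norm _).trans ?_
  rw [norm_mul, norm_mul, norm_star]
  have h1 := norm_le_pi_norm x i
  have h2 := norm_le_pi_norm y j
  calc ‖x i‖ * (‖M i j‖ * ‖y j‖) = ‖M i j‖ * (‖x i‖ * ‖y j‖) := by ring
    _ ≤ _ := by gcongr

theorem aestronglyMeasurable_apply {α : Type*} {μ : Measure ℝ} {x : ℝ → α → ℂ}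
    (hx : AEStronglyMeasurable x μ) (i : α) : AEStronglyMeasurable (fun t => x t i) μ :=
  (continuous_apply i).comp_aestronglyMeasurable hx

theorem aestronglyMeasurable_vector {μ : Measure ℝ} {x : ℝ → ι → ℂ}
    (h : ∀ i, AEStronglyMeasurable (fun t => x t i) μ) : AEStronglyMeasurable x μ :=
  (aemeasurable_pi_iff.2 fun i => (h i).aemeasurable).aestronglyMeasurable

theorem aestronglyMeasurable_sesq {μ : Measure ℝ} {M : ℝ → Matrix ι κ ℂ} {x : ℝ → ι → ℂ}
    {y : ℝ → κ → ℂ} (hM : ∀ i j, AEStronglyMeasurable (fun t => M t i j) μ)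
    (hx : AEStronglyMeasurable x μ) (hy : AEStronglyMeasurable y μ) :
    AEStronglyMeasurable (fun t => sesq (M t) (x t) (y t)) μ := by
  simp only [sesq_eq_sum]
  refine Finset.aestronglyMeasurable_fun_sum _ fun i _ =>
    Finset.aestronglyMeasurable_fun_sum _ fun j _ => ?_
  exact Complex.continuous_re.comp_aestronglyMeasurable
    ((continuous_star.comp_aestronglyMeasurable (aestronglyMeasurable_apply hx i)).mul
      ((hM i j).mul (aestronglyMeasurable_apply hy j)))

theorem aestronglyMeasurable_mulVec {μ : Measure ℝ} {M : ℝ → Matrix ι κ ℂ} {y : ℝ → κ → ℂ}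
    (hM : ∀ i j, AEStronglyMeasurable (fun t => M t i j) μ) (hy : AEStronglyMeasurable y μ) :
    AEStronglyMeasurable (fun t => M t *ᵥ y t) μ :=
  aestronglyMeasurable_vector fun i => Finset.aestronglyMeasurable_fun_sum _ fun j _ =>
    (hM i j).mul (aestronglyMeasurable_apply hy j)

theorem integrable_entryNorm {μ : Measure ℝ} {M : ℝ → Matrix ι κ ℂ}
    (h : ∀ i j, Integrable (fun t => M t i j) μ) : Integrable (fun t => entryNorm (M t)) μ :=
  integrable_finsetSum _ fun i _ => integrable_finsetSum _ fun j _ => (h i j).norm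

theorem integrable_mulVec {μ : Measure ℝ} {M : ℝ → Matrix ι κ ℂ} {y : ℝ → κ → ℂ}
    (hM : ∀ i j, Integrable (fun t => M t i j) μ) (hy : AEStronglyMeasurable y μ) {R : ℝ}
    (hR : ∀ᵐ t ∂μ, ‖y t‖ ≤ R) : Integrable (fun t => M t *ᵥ y t) μ := by
  refine Integrable.mono' ((integrable_entryNorm hM).mul_const R)
    (aestronglyMeasurable_mulVec (fun i j => (hM i j).1) hy) ?_
  filter_upwards [hR] with t ht
  refine (norm_mulVec_le _ _).trans ?_
  have := entryNorm_nonneg (M t)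
  gcongr

/-- The case of an integrable matrix between bounded vectors, as for the KYP integrand along
continuous data. -/
theorem integrable_sesq_of_matrix {μ : Measure ℝ} {M : ℝ → Matrix ι κ ℂ} {x : ℝ → ι → ℂ}
    {y : ℝ → κ → ℂ} (hM : ∀ i j, Integrable (fun t => M t i j) μ) (hx : AEStronglyMeasurable x μ)
    (hy : AEStronglyMeasurable y μ) {R : ℝ} (hxR : ∀ᵐ t ∂μ, ‖x t‖ ≤ R)
    (hyR : ∀ᵐ t ∂μ, ‖y t‖ ≤ R) : Integrable (fun t => sesq (M t) (x t) (y t)) μ := by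
  refine Integrable.mono' (g := fun t => entryNorm (M t) * (R * R))
    ((integrable_entryNorm hM).mul_const _)
    (aestronglyMeasurable_sesq (fun i j => (hM i j).1) hx hy) ?_
  filter_upwards [hxR, hyR] with t h1 h2
  refine (abs_sesq_le _ _ _).trans ?_
  have := (norm_nonneg _).trans h1
  have := entryNorm_nonneg (M t)
  gcongr

/-- The complementary case of a bounded matrix and a merely integrable right vector, as for `Q`
paired with `ẋ`. -/
theorem integrable_sesq_of_right {μ : Measure ℝ} {M : ℝ → Matrix ι κ ℂ} {x : ℝ → ι → ℂ}
    {y : ℝ → κ → ℂ} (hy : Integrable y μ) (hM : ∀ i j, AEStronglyMeasurable (fun t => M t i j) μ)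
    (hx : AEStronglyMeasurable x μ) {R K : ℝ} (hxR : ∀ᵐ t ∂μ, ‖x t‖ ≤ R)
    (hMK : ∀ᵐ t ∂μ, entryNorm (M t) ≤ K) : Integrable (fun t => sesq (M t) (x t) (y t)) μ := by
  refine Integrable.mono' (g := fun t => K * (R * ‖y t‖))
    ((hy.norm.const_mul R).const_mul K) (aestronglyMeasurable_sesq hM hx hy.1) ?_
  filter_upwards [hxR, hMK] with t h1 h2
  refine (abs_sesq_le _ _ _).trans ?_
  have := (norm_nonneg _).trans h1
  have := (entryNorm_nonneg _).trans h2
  gcongr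

/-- The form `y ↦ Re (xᴴ M y)` as a continuous linear map. -/
noncomputable def sesqRightCLM (M : Matrix ι κ ℂ) (x : ι → ℂ) : (κ → ℂ) →L[ℝ] ℝ where
  toFun y := sesq M x y
  map_add' y y' := sesq_add_right M x y y'
  map_smul' c y := by simp [sesq, Matrix.mulVec_smul]
  cont := by unfold sesq; fun_prop

theorem sesq_intervalIntegral_right (M : Matrix ι κ ℂ) (x : ι → ℂ) {a b : ℝ} {g : ℝ → κ → ℂ}
    (hg : IntervalIntegrable g volume a b) :
    sesq M x (∫ t in a..b, g t) = ∫ t in a..b, sesq M x (g t) :=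
  ((sesqRightCLM M x).intervalIntegral_comp_comm hg).symm

theorem sesq_intervalIntegral_matrix {a b : ℝ} {M : ℝ → Matrix ι κ ℂ}
    (hM : ∀ i j, IntervalIntegrable (fun t => M t i j) volume a b) (x : ι → ℂ) (y : κ → ℂ) :
    sesq (Matrix.of fun i j => ∫ t in a..b, M t i j) x y = ∫ t in a..b, sesq (M t) x y := by
  have key : ∀ i j, IntervalIntegrable (fun t => (star (x i) * (M t i j * y j)).re) volume a b :=
    fun i j => ((((hM i j).mul_const (y j)).const_mul (star (x i))) |> fun h =>
      ⟨Complex.reCLM.integrable_comp h.1, Complex.reCLM.integrable_comp h.2⟩)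
  simp only [sesq_eq_sum, Matrix.of_apply]
  have key' : ∀ i, IntervalIntegrable (fun t => ∑ j, (star (x i) * (M t i j * y j)).re)
      volume a b := fun i => by
    simpa only [Finset.sum_fn] using IntervalIntegrable.sum Finset.univ fun j _ => key i j
  rw [intervalIntegral.integral_finsetSum fun i _ => key' i]
  refine Finset.sum_congr rfl fun i _ => ?_
  rw [intervalIntegral.integral_finsetSum fun j _ => key i j]
  refine Finset.sum_congr rfl fun j _ => ?_
  have h := Complex.reCLM.intervalIntegral_comp_comm
    (((hM i j).mul_const (y j)).const_mul (star (x i)))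
  simp only [Complex.reCLM_apply] at h
  rw [h, intervalIntegral.integral_const_mul, intervalIntegral.integral_mul_const]

end Sesq

/-! ### Monotonicity from local estimates -/

/-- If the decrease of `φ` over short intervals is at most `ε` times the increase of a fixed
function `w`, for every `ε`, then `φ` does not decrease. -/
theorem le_of_local_increment {φ w : ℝ → ℝ} {a b : ℝ} (hab : a ≤ b)
    (h : ∀ ε > 0, ∃ δ > 0, ∀ s s', a ≤ s → s ≤ s' → s' ≤ b → s' - s < δ →
      φ s - φ s' ≤ ε * (w s' - w s)) : φ a ≤ φ b := by
  have key : ∀ ε > 0, φ a - φ b ≤ ε * (w b - w a) := by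
    intro ε hε
    obtain ⟨δ, hδ, hs⟩ := h ε hε
    -- With `N` equal steps each is shorter than `δ`, and the local estimates telescope.
    obtain ⟨N, hN⟩ := exists_nat_gt ((b - a) / δ)
    have hN0 : (0 : ℝ) < N := lt_of_le_of_lt (by have := sub_nonneg.2 hab; positivity) hN
    have hstep : (b - a) / N < δ := by
      rw [div_lt_iff₀ hδ] at hN
      rw [div_lt_iff₀ hN0]; linarith
    have hstep0 : 0 ≤ (b - a) / N := by have := sub_nonneg.2 hab; positivity
    have hNb : (N : ℝ) * ((b - a) / N) = b - a := by field_simp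
    have ind : ∀ k : ℕ, k ≤ N → φ a - φ (a + k * ((b - a) / N)) ≤
        ε * (w (a + k * ((b - a) / N)) - w a) := by
      intro k
      induction k with
      | zero => simp
      | succ k ih =>
        intro hk
        have hk' : ((k : ℝ) + 1) ≤ N := by exact_mod_cast hk
        have h1 := ih (by omega)
        have h2 := hs (a + k * ((b - a) / N)) (a + (k + 1) * ((b - a) / N))
          (by have : (0 : ℝ) ≤ k := by positivity
              nlinarith) (by nlinarith)
          (by nlinarith) (by linarith)
        push_cast
        linarith
    have := ind N le_rfl
    rw [hNb] at this
    simpa using this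
  by_contra! hlt
  -- `w` is not assumed monotone; a strict decrease of `φ` and the estimate with `ε = 1` force `w a
  -- < w b`. The next choice of `ε` then bounds the decrease by half of itself.
  have hw := key 1 one_pos
  have hpos : 0 < w b - w a := by linarith
  have := key ((φ a - φ b) / (2 * (w b - w a))) (by have := sub_pos.2 hlt; positivity)
  have e : (φ a - φ b) / (2 * (w b - w a)) * (w b - w a) = (φ a - φ b) / 2 := by
    field_simp
  linarith


/-! ### Local integrability on an interval -/

/-- `f` is integrable over every compact interval with endpoints in `T`. -/
def LocInt {E : Type*} [NormedAddCommGroup E] (T : Set ℝ) (f : ℝ → E) : Prop :=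
  ∀ s ∈ T, ∀ t ∈ T, IntervalIntegrable f volume s t

/-- The least and greatest points of `K` can be pushed outward inside the open set `T`. This turns
integrals against compactly supported test functions into interval integrals. -/
theorem exists_Ioo_of_isCompact {T K : Set ℝ} (hT : IsOpen T) (hK : IsCompact K) (hKT : K ⊆ T)
    (hne : K.Nonempty) : ∃ a ∈ T, ∃ b ∈ T, a < b ∧ K ⊆ Set.Ioo a b := by
  obtain ⟨p, hp, hpl⟩ := hK.exists_isLeast hne
  obtain ⟨q, hq, hqg⟩ := hK.exists_isGreatest hne
  obtain ⟨ε, hε, hb⟩ := Metric.isOpen_iff.1 hT p (hKT hp)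
  obtain ⟨η, hη, hc⟩ := Metric.isOpen_iff.1 hT q (hKT hq)
  refine ⟨p - ε / 2, hb ?_, q + η / 2, hc ?_, ?_, fun z hz => ⟨?_, ?_⟩⟩
  · rw [Metric.mem_ball, Real.dist_eq, abs_lt]; constructor <;> linarith
  · rw [Metric.mem_ball, Real.dist_eq, abs_lt]; constructor <;> linarith
  · have := hpl hq; linarith
  · have := hpl hz; linarith
  · have := hqg hz; linarith

theorem MemLpLoc.mono_exponent {T : Set ℝ} {p q : ENNReal} {f : ℝ → ℂ} (hf : MemLpLoc T q f)
    (hpq : p ≤ q) : MemLpLoc T p f := fun K hKT hK => by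
  have : IsFiniteMeasure (volume.restrict K) := ⟨by simpa using hK.measure_lt_top⟩
  exact (hf K hKT hK).mono_exponent hpq

theorem MemLpLoc.memLp_uIcc {T : Set ℝ} (hT' : T.OrdConnected) {p : ENNReal} {f : ℝ → ℂ}
    (hf : MemLpLoc T p f) {s t : ℝ} (hs : s ∈ T) (ht : t ∈ T) :
    MemLp f p (volume.restrict (Set.uIoc s t)) :=
  (hf _ (hT'.uIcc_subset hs ht) isCompact_uIcc).mono_measure
    (Measure.restrict_mono Set.uIoc_subset_uIcc le_rfl)

theorem MemLpLoc.locInt {T : Set ℝ} (hT' : T.OrdConnected) {p : ENNReal} (hp : 1 ≤ p) {f : ℝ → ℂ}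
    (hf : MemLpLoc T p f) : LocInt T f := fun s hs t ht => by
  rw [intervalIntegrable_iff]
  exact memLp_one_iff_integrable.1 ((hf.mono_exponent hp).memLp_uIcc hT' hs ht)

theorem LocInt.memLpLoc {T : Set ℝ} (hT : IsOpen T) {f : ℝ → ℂ} (hf : LocInt T f) :
    MemLpLoc T 1 f := fun K hKT hK => by
  rcases K.eq_empty_or_nonempty with rfl | hne
  · simp
  obtain ⟨a, ha, b, hb, hab, hsub⟩ := exists_Ioo_of_isCompact hT hK hKT hne
  have h := (intervalIntegrable_iff_integrableOn_Ioc_of_le hab.le).1 (hf a ha b hb)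
  exact (memLp_one_iff_integrable.2 h).mono_measure
    (Measure.restrict_mono (hsub.trans Set.Ioo_subset_Ioc_self) le_rfl)

theorem locInt_of_continuousOn {E : Type*} [NormedAddCommGroup E] {T : Set ℝ}
    (hT' : T.OrdConnected) {f : ℝ → E} (hf : ContinuousOn f T) : LocInt T f := fun _ hs _ ht =>
  (hf.mono (hT'.uIcc_subset hs ht)).intervalIntegrable

theorem locInt_pi {ι : Type*} [Fintype ι] {T : Set ℝ} {f : ℝ → ι → ℂ} :
    LocInt T f ↔ ∀ i, LocInt T fun t => f t i := by
  simp only [LocInt, intervalIntegrable_iff, IntegrableOn]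
  constructor
  · intro h i s hs t ht
    exact (ContinuousLinearMap.proj (R := ℝ) (φ := fun _ : ι => ℂ) i).integrable_comp (h s hs t ht)
  · intro h s hs t ht
    exact Integrable.of_eval fun i => h i s hs t ht

/-! ### Weak derivatives and absolutely continuous functions -/

theorem absolutelyContinuousOnInterval_of_dist_le {E : Type*} [PseudoMetricSpace E] {f : ℝ → E}
    {N : ℝ → ℝ} {a b : ℝ} (hN : AbsolutelyContinuousOnInterval N a b)
    (h : ∀ u ∈ Set.uIcc a b, ∀ v ∈ Set.uIcc a b, dist (f u) (f v) ≤ dist (N u) (N v)) :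
    AbsolutelyContinuousOnInterval f a b := by
  rw [absolutelyContinuousOnInterval_iff] at hN ⊢
  intro ε hε
  obtain ⟨δ, hδ, H⟩ := hN ε hε
  refine ⟨δ, hδ, fun I hI hlt => lt_of_le_of_lt (Finset.sum_le_sum fun i hi => ?_) (H I hI hlt)⟩
  exact h _ (hI.1 i hi).1 _ (hI.1 i hi).2

/-- Increments of the vector-valued primitive are dominated by those of the primitive of `‖g‖`, so
the real-valued case transfers. -/
theorem absolutelyContinuousOnInterval_primitive {E : Type*} [NormedAddCommGroup E]
    [NormedSpace ℝ E] {g : ℝ → E} {a b : ℝ} (hg : IntervalIntegrable g volume a b) :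
    AbsolutelyContinuousOnInterval (fun t => ∫ τ in a..t, g τ) a b := by
  refine absolutelyContinuousOnInterval_of_dist_le
    (hg.norm.absolutelyContinuousOnInterval_intervalIntegral (c := a) Set.left_mem_uIcc)
    fun u hu v hv => ?_
  have hau : IntervalIntegrable g volume a u := hg.mono_set (Set.uIcc_subset_uIcc_left hu)
  have hav : IntervalIntegrable g volume a v := hg.mono_set (Set.uIcc_subset_uIcc_left hv)
  rw [dist_eq_norm, Real.dist_eq, intervalIntegral.integral_interval_sub_left hau hav,
    intervalIntegral.integral_interval_sub_left hau.norm hav.norm]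
  exact intervalIntegral.norm_integral_le_abs_integral_norm

/-- Integration by parts on a compact interval. -/
theorem integral_deriv_smul_primitive {E : Type*} [NormedAddCommGroup E] [NormedSpace ℝ E]
    [CompleteSpace E] {g : ℝ → E} {a b : ℝ} (hg : IntervalIntegrable g volume a b)
    (c : E) {φ : ℝ → ℝ} (hφ : ContDiff ℝ ∞ φ) (ha : φ a = 0) (hb : φ b = 0) :
    ∫ t in a..b, deriv φ t • (c + ∫ τ in a..t, g τ) = -∫ t in a..b, φ t • g t := by
  set G : ℝ → E := fun t => c + ∫ τ in a..t, g τ with hG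
  have hGc : ContinuousOn G (Set.uIcc a b) :=
    continuousOn_const.add (intervalIntegral.continuousOn_primitive_interval' hg Set.left_mem_uIcc)
  have hφ' : Continuous (deriv φ) := hφ.continuous_deriv (by simp)
  have hi1 : IntervalIntegrable (fun t => deriv φ t • G t) volume a b :=
    (hφ'.continuousOn.smul hGc).intervalIntegrable
  have hi2 : IntervalIntegrable (fun t => φ t • g t) volume a b :=
    hg.continuousOn_smul hφ.continuous.continuousOn
  have hacG : AbsolutelyContinuousOnInterval G a b :=
    absolutelyContinuousOnInterval_of_dist_le
      (N := fun t => ∫ τ in a..t, ‖g τ‖)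
      (hg.norm.absolutelyContinuousOnInterval_intervalIntegral (c := a) Set.left_mem_uIcc)
      fun u hu v hv => by
        have hau : IntervalIntegrable g volume a u := hg.mono_set (Set.uIcc_subset_uIcc_left hu)
        have hav : IntervalIntegrable g volume a v := hg.mono_set (Set.uIcc_subset_uIcc_left hv)
        simp only [hG]
        rw [dist_add_left, dist_eq_norm, Real.dist_eq,
          intervalIntegral.integral_interval_sub_left hau hav,
          intervalIntegral.integral_interval_sub_left hau.norm hav.norm]
        exact intervalIntegral.norm_integral_le_abs_integral_norm
  have hacφ : AbsolutelyContinuousOnInterval φ a b :=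
    ((hφ.of_le (by simp)).contDiffOn).absolutelyContinuousOnInterval
  -- `φ • G` minus the primitive of its almost-everywhere derivative is absolutely continuous with
  -- zero derivative almost everywhere, hence constant; compare the endpoints.
  have hacH := (hacφ.smul hacG).sub (absolutelyContinuousOnInterval_primitive (hi1.add hi2))
  obtain ⟨C, hC⟩ := hacH.const_of_ae_hasDerivAt_zero (by
    filter_upwards [hg.ae_hasDerivAt_integral, (hi1.add hi2).ae_hasDerivAt_integral]
      with t h1 h2 ht
    have d1 := h1 ht a Set.left_mem_uIcc
    have d2 := h2 ht a Set.left_mem_uIcc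
    have d3 : HasDerivAt φ (deriv φ t) t :=
      ((hφ.differentiable (by simp)) t).hasDerivAt
    have d4 := (d3.smul (d1.const_add c)).sub d2
    convert! d4 using 1
    simp [hG]
    abel)
  have e1 := hC a Set.left_mem_uIcc
  have e2 := hC b Set.right_mem_uIcc
  simp only [Pi.sub_apply, Pi.smul_apply', ha, hb, zero_smul, intervalIntegral.integral_same,
    sub_zero, zero_sub] at e1 e2
  rw [← e1, neg_eq_zero, intervalIntegral.integral_add hi1 hi2] at e2
  exact eq_neg_of_add_eq_zero_left e2

theorem setIntegral_eq_intervalIntegral_of_tsupport {E : Type*} [NormedAddCommGroup E]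
    [NormedSpace ℝ E] {T : Set ℝ} (hTm : MeasurableSet T)
    {a b : ℝ} (hab : a ≤ b) (hsub : Set.Icc a b ⊆ T) {f : ℝ → E}
    (hf : ∀ t, t ∉ Set.Ioo a b → f t = 0) : ∫ t in T, f t = ∫ t in a..b, f t := by
  rw [intervalIntegral.integral_of_le hab]
  exact setIntegral_eq_of_subset_of_forall_sdiff_eq_zero hTm
    (Set.Ioc_subset_Icc_self.trans hsub)
    fun t ht => hf t fun h => ht.2 (Set.Ioo_subset_Ioc_self h)

theorem deriv_eq_zero_of_notMem_tsupport {φ : ℝ → ℝ} {t : ℝ} (ht : t ∉ tsupport φ) :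
    deriv φ t = 0 :=
  Function.notMem_support.1 fun h => ht (support_deriv_subset h)

/-- A primitive of `g` on `T` has `g` as its weak derivative. -/
theorem integral_deriv_mul_eq_neg_of_primitive {T : Set ℝ} (hT : IsOpen T) (hT' : T.OrdConnected)
    {f g : ℝ → ℂ} (hg : LocInt T g) (hfg : ∀ s ∈ T, ∀ t ∈ T, f t - f s = ∫ τ in s..t, g τ)
    {φ : ℝ → ℝ} (hφ : ContDiff ℝ ∞ φ) (hc : HasCompactSupport φ) (hsub : tsupport φ ⊆ T) :
    ∫ t in T, ((deriv φ t : ℝ) : ℂ) * f t = -∫ t in T, ((φ t : ℝ) : ℂ) * g t := by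
  rcases (tsupport φ).eq_empty_or_nonempty with he | hne
  · have : φ = 0 := tsupport_eq_empty_iff.1 he
    simp [this]
  obtain ⟨a, ha, b, hb, hab, hK⟩ := exists_Ioo_of_isCompact hT hc hsub hne
  have h0 : ∀ t, t ∉ Set.Ioo a b → φ t = 0 := fun t ht =>
    image_eq_zero_of_notMem_tsupport fun h => ht (hK h)
  have h1 : ∀ t, t ∉ Set.Ioo a b → deriv φ t = 0 := fun t ht =>
    deriv_eq_zero_of_notMem_tsupport fun h => ht (hK h)
  have hI : Set.Icc a b ⊆ T := hT'.out ha hb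
  rw [setIntegral_eq_intervalIntegral_of_tsupport hT.measurableSet hab.le hI
      fun t ht => by rw [h1 t ht]; simp,
    setIntegral_eq_intervalIntegral_of_tsupport hT.measurableSet hab.le hI
      fun t ht => by rw [h0 t ht]; simp]
  have key := integral_deriv_smul_primitive (hg a ha b hb) (f a) hφ
    (h0 a (by simp)) (h0 b (by simp))
  simp only [Complex.real_smul] at key
  rw [← key]
  refine intervalIntegral.integral_congr fun t ht => ?_
  rw [Set.uIcc_of_le hab.le] at ht
  rw [← hfg a ha t (hI ht)]
  ring

/-- A continuous function with vanishing weak derivative is constant. -/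
theorem eq_of_integral_deriv_mul_eq_zero {T : Set ℝ} (hT : IsOpen T) (hT' : T.OrdConnected)
    {h : ℝ → ℂ} (hc : ContinuousOn h T)
    (hw : ∀ φ : ℝ → ℝ, ContDiff ℝ ∞ φ → HasCompactSupport φ → tsupport φ ⊆ T →
      ∫ t in T, ((deriv φ t : ℝ) : ℂ) * h t = 0) :
    ∀ s ∈ T, ∀ t ∈ T, h t = h s := by
  intro s hs
  obtain ⟨ε, hε, hball⟩ := Metric.isOpen_iff.1 hT s hs
  -- A fixed test function `ψ₀` of integral one; its pairing `c` with `h` will be the constant value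
  -- of `h`.
  let B : ContDiffBump s := ⟨ε / 4, ε / 2, by positivity, by linarith⟩
  set ψ₀ : ℝ → ℝ := B.normed volume with hψ₀
  have hψ₀d : ContDiff ℝ ∞ ψ₀ := B.contDiff_normed
  have hψ₀c : HasCompactSupport ψ₀ := B.hasCompactSupport_normed
  have hψ₀s : tsupport ψ₀ ⊆ T := by
    rw [hψ₀, B.tsupport_normed_eq]
    exact (Metric.closedBall_subset_ball (by show ε / 2 < ε; linarith)).trans hball
  have hψ₀i : ∫ t, ψ₀ t = 1 := B.integral_normed
  set c : ℂ := ∫ t in T, (ψ₀ t : ℂ) * h t with hcdef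
  have hint : ∀ ψ : ℝ → ℝ, Continuous ψ → HasCompactSupport ψ → tsupport ψ ⊆ T →
      Integrable (fun t => (ψ t : ℂ) * h t) (volume.restrict T) := by
    intro ψ h1 h2 h3
    have : IntegrableOn (fun t => (ψ t : ℂ) * h t) (tsupport ψ) volume :=
      ((Complex.continuous_ofReal.comp h1).continuousOn.mul
        (hc.mono h3)).integrableOn_compact h2
    refine Integrable.mono_measure ?_ Measure.restrict_le_self
    exact (integrableOn_iff_integrable_of_support_subset
      (fun t ht => subset_tsupport _ (by
        intro h0
        apply ht
        simp [h0]))).1 this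
  have hmain : ∀ ψ : ℝ → ℝ, ContDiff ℝ ∞ ψ → HasCompactSupport ψ → tsupport ψ ⊆ T →
      ∫ t in T, (ψ t : ℂ) * h t = (∫ t, ψ t : ℝ) * c := by
    intro ψ h1 h2 h3
    -- Subtracting a multiple of `ψ₀` makes the integral vanish, so the primitive of `θ` is again a
    -- test function supported in `T`, to which `hw` applies.
    set θ : ℝ → ℝ := fun t => ψ t - (∫ t, ψ t) * ψ₀ t with hθ
    have hθd : ContDiff ℝ ∞ θ := h1.sub (contDiff_const.mul hψ₀d)
    have hne : (tsupport ψ ∪ tsupport ψ₀).Nonempty := by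
      refine Set.Nonempty.inr ⟨s, subset_tsupport _ ?_⟩
      exact (B.nonneg_normed s).lt_of_ne' (by
        have := B.support_normed_eq (μ := volume)
        have hm : s ∈ Function.support (B.normed volume) := by
          rw [this]; exact Metric.mem_ball_self B.rOut_pos
        exact hm) |>.ne'
    obtain ⟨a, ha, b, hb, hab, hK⟩ := exists_Ioo_of_isCompact hT
      (h2.isCompact.union hψ₀c.isCompact) (Set.union_subset h3 hψ₀s) hne
    have hθ0 : ∀ t, t ∉ Set.Ioo a b → θ t = 0 := fun t ht => by
      have e1 : ψ t = 0 := image_eq_zero_of_notMem_tsupport fun h => ht (hK (Or.inl h))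
      have e2 : ψ₀ t = 0 := image_eq_zero_of_notMem_tsupport fun h => ht (hK (Or.inr h))
      simp [hθ, e1, e2]
    have hθi : ∫ t in a..b, θ t = 0 := by
      have e : ∫ t, θ t = 0 := by
        simp only [hθ]
        rw [integral_sub (h1.continuous.integrable_of_hasCompactSupport h2)
          ((hψ₀d.continuous.integrable_of_hasCompactSupport hψ₀c).const_mul _),
          integral_const_mul, hψ₀i, mul_one, sub_self]
      rw [← e, intervalIntegral.integral_of_le hab.le]
      exact setIntegral_eq_integral_of_forall_compl_eq_zero
        fun t ht => hθ0 t fun h => ht (Set.Ioo_subset_Ioc_self h)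
    set φ : ℝ → ℝ := fun t => ∫ τ in a..t, θ τ with hφ
    have hφd : ∀ t, HasDerivAt φ (θ t) t := fun t =>
      intervalIntegral.integral_hasDerivAt_right (hθd.continuous.intervalIntegrable _ _)
        hθd.continuous.stronglyMeasurable.stronglyMeasurableAtFilter hθd.continuous.continuousAt
    have hφ' : deriv φ = θ := funext fun t => (hφd t).deriv
    have hφs : ContDiff ℝ ∞ φ := contDiff_infty_iff_deriv.2
      ⟨fun t => (hφd t).differentiableAt, by rw [hφ']; exact hθd⟩
    have hφ0 : Function.support φ ⊆ Set.Icc a b := by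
      intro t ht
      by_contra hcon
      apply ht
      rcases lt_or_ge t a with hta | hta
      · refine intervalIntegral.integral_zero_ae (ae_of_all _ fun τ hτ => hθ0 τ fun h => ?_)
        rw [Set.uIoc_of_ge hta.le] at hτ
        exact absurd h.1 (not_lt.2 hτ.2)
      · have htb : b < t := by
          by_contra hle
          exact hcon ⟨hta, not_lt.1 hle⟩
        have e := intervalIntegral.integral_add_adjacent_intervals
          (hθd.continuous.intervalIntegrable (μ := volume) a b)
          (hθd.continuous.intervalIntegrable (μ := volume) b t)
        simp only [hφ]
        rw [← e, hθi, zero_add]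
        refine intervalIntegral.integral_zero_ae (ae_of_all _ fun τ hτ => hθ0 τ fun h => ?_)
        rw [Set.uIoc_of_le htb.le] at hτ
        exact absurd h.2 (not_lt.2 hτ.1.le)
    have hts : tsupport φ ⊆ Set.Icc a b := closure_minimal hφ0 isClosed_Icc
    have := hw φ hφs (HasCompactSupport.of_support_subset_isCompact isCompact_Icc hφ0)
      (hts.trans (hT'.out ha hb))
    rw [hφ'] at this
    simp only [hθ] at this
    have e : ∀ t, (((ψ t - (∫ t, ψ t) * ψ₀ t : ℝ)) : ℂ) * h t =
        (ψ t : ℂ) * h t - ((∫ t, ψ t : ℝ) : ℂ) * ((ψ₀ t : ℂ) * h t) := fun t => by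
      push_cast; ring
    simp only [e] at this
    rw [integral_sub (hint ψ h1.continuous h2 h3)
      ((hint ψ₀ hψ₀d.continuous hψ₀c hψ₀s).const_mul _), integral_const_mul] at this
    exact sub_eq_zero.1 this
  -- By `hmain`, `h - c` integrates to zero against every test function.
  have hae : ∀ᵐ t, t ∈ T → h t - c = 0 := by
    refine hT.ae_eq_zero_of_integral_contDiff_smul_eq_zero
      ((hc.sub continuousOn_const).locallyIntegrableOn hT.measurableSet) fun ψ h1 h2 h3 => ?_
    have e0 : ∫ t, ψ t • (h t - c) = ∫ t in T, ψ t • (h t - c) := by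
      refine (setIntegral_eq_integral_of_forall_compl_eq_zero fun t ht => ?_).symm
      rw [image_eq_zero_of_notMem_tsupport fun hh => ht (h3 hh), zero_smul]
    have e1 : ∀ t, ψ t • (h t - c) = (ψ t : ℂ) * h t - (ψ t : ℂ) * c := fun t => by
      rw [Complex.real_smul]; ring
    have hψint : Integrable (fun t => (ψ t : ℂ)) (volume.restrict T) :=
      ((h1.continuous.integrable_of_hasCompactSupport h2).ofReal).restrict
    rw [e0]
    simp only [e1]
    rw [integral_sub (hint ψ h1.continuous h2 h3) (hψint.mul_const c), hmain ψ h1 h2 h3,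
      integral_mul_const, integral_complex_ofReal, sub_eq_zero]
    congr 2
    refine (setIntegral_eq_integral_of_forall_compl_eq_zero fun t ht => ?_).symm
    exact image_eq_zero_of_notMem_tsupport fun hh => ht (h3 hh)
  have heq : Set.EqOn h (fun _ => c) T := by
    refine Measure.eqOn_open_of_ae_eq (μ := volume) ?_ hT hc continuousOn_const
    rw [Filter.EventuallyEq, ae_restrict_iff' hT.measurableSet]
    filter_upwards [hae] with t ht htT
    exact sub_eq_zero.1 (ht htT)
  intro t ht
  rw [heq ht, heq hs]

theorem continuousOn_of_sub_eq_integral {E : Type*} [NormedAddCommGroup E] [NormedSpace ℝ E]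
    {T : Set ℝ} (hT : IsOpen T) {f g : ℝ → E} (hg : LocInt T g)
    (hfg : ∀ s ∈ T, ∀ t ∈ T, f t - f s = ∫ τ in s..t, g τ) : ContinuousOn f T := by
  intro t ht
  obtain ⟨a, ha, b, hb, hab, hK⟩ := exists_Ioo_of_isCompact hT (isCompact_singleton (x := t))
    (by simpa using ht) ⟨t, rfl⟩
  have htI : t ∈ Set.Ioo a b := hK rfl
  have h1 : ContinuousOn (fun r => f a + ∫ τ in a..r, g τ) (Set.uIcc a b) :=
    continuousOn_const.add
      (intervalIntegral.continuousOn_primitive_interval' (hg a ha b hb) Set.left_mem_uIcc)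
  rw [Set.uIcc_of_le hab.le] at h1
  have h2 := h1.continuousAt (Icc_mem_nhds htI.1 htI.2)
  refine ContinuousAt.continuousWithinAt (h2.congr ?_)
  filter_upwards [hT.mem_nhds ht] with r hr
  rw [← hfg a ha r hr]
  abel

/-- A continuous function on an open interval has weak derivative `g` if and only if `g` is
locally integrable and the function is a primitive of `g`. -/
theorem hasWeakDeriv_iff {T : Set ℝ} (hT : IsOpen T) (hT' : T.OrdConnected) {n : ℕ}
    {f g : ℝ → Fin n → ℂ} : (ContinuousOn f T ∧ HasWeakDeriv T f g) ↔
      (LocInt T g ∧ ∀ s ∈ T, ∀ t ∈ T, f t - f s = ∫ τ in s..t, g τ) := by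
  have happ : LocInt T g → ∀ s ∈ T, ∀ t ∈ T, ∀ i,
      (∫ τ in s..t, g τ) i = ∫ τ in s..t, g τ i := fun hg s hs t ht i =>
    ((ContinuousLinearMap.proj (R := ℝ) (φ := fun _ : Fin n => ℂ) i).intervalIntegral_comp_comm
      (hg s hs t ht)).symm
  constructor
  · rintro ⟨hfc, -, hg1, hw⟩
    have hgi : ∀ i, LocInt T fun t => g t i := fun i => (hg1 i).locInt hT' le_rfl
    have hg := locInt_pi.2 hgi
    refine ⟨hg, fun s hs t ht => funext fun i => ?_⟩
    have hfi : ContinuousOn (fun r => f r i) T := (continuous_apply i).comp_continuousOn hfc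
    -- `G` is a primitive of the same weak derivative, so the component of `f` minus `G` has zero
    -- weak derivative and is constant.
    set G : ℝ → ℂ := fun r => ∫ τ in s..r, g τ i with hG
    have hGsub : ∀ p ∈ T, ∀ q ∈ T, G q - G p = ∫ τ in p..q, g τ i := fun p hp q hq =>
      intervalIntegral.integral_interval_sub_left (hgi i s hs q hq) (hgi i s hs p hp)
    have hGc := continuousOn_of_sub_eq_integral hT (hgi i) hGsub
    have := eq_of_integral_deriv_mul_eq_zero hT hT' (hfi.sub hGc) (fun φ h1 h2 h3 => by
      have e1 := hw φ h1 h2 h3 i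
      have e2 := integral_deriv_mul_eq_neg_of_primitive hT hT' (hgi i) hGsub h1 h2 h3
      have hint : ∀ k : ℝ → ℂ, ContinuousOn k T →
          Integrable (fun t => ((deriv φ t : ℝ) : ℂ) * k t) (volume.restrict T) := by
        intro k hk
        have : IntegrableOn (fun t => ((deriv φ t : ℝ) : ℂ) * k t) (tsupport φ) volume :=
          ((Complex.continuous_ofReal.comp (h1.continuous_deriv (by simp))).continuousOn.mul
            (hk.mono h3)).integrableOn_compact h2
        refine Integrable.mono_measure ?_ Measure.restrict_le_self
        exact (integrableOn_iff_integrable_of_support_subset (fun t ht => by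
          by_contra h0
          apply ht
          simp [deriv_eq_zero_of_notMem_tsupport h0])).1 this
      simp only [Pi.sub_apply, mul_sub]
      rw [integral_sub (hint _ hfi) (hint _ hGc), e1, e2, sub_self]) s hs t ht
    simp only [hG, Pi.sub_apply, intervalIntegral.integral_same, sub_zero] at this
    rw [happ hg s hs t ht, Pi.sub_apply, ← this]
    ring
  · rintro ⟨hg, hfg⟩
    have hfc := continuousOn_of_sub_eq_integral hT hg hfg
    have hgi := locInt_pi.1 hg
    refine ⟨hfc, fun i => (locInt_of_continuousOn hT'
      ((continuous_apply i).comp_continuousOn hfc)).memLpLoc hT,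
      fun i => (hgi i).memLpLoc hT, fun φ h1 h2 h3 i => ?_⟩
    refine integral_deriv_mul_eq_neg_of_primitive hT hT' (hgi i) (fun s hs t ht => ?_) h1 h2 h3
    rw [← happ hg s hs t ht, ← hfg s hs t ht, Pi.sub_apply]


/-! ### Linear differential equations with locally integrable coefficients -/

theorem AbsolutelyContinuousOnInterval.pow_succ {f : ℝ → ℝ} {a b : ℝ}
    (hf : AbsolutelyContinuousOnInterval f a b) (k : ℕ) :
    AbsolutelyContinuousOnInterval (f ^ (k + 1)) a b := by
  induction k with
  | zero => simpa using hf
  | succ k ih => rw [_root_.pow_succ]; exact ih.mul hf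

/-- The power `P ^ (k + 1)` of the primitive `P` is absolutely continuous with derivative `(k + 1) α
P ^ k` almost everywhere. The fundamental theorem for absolutely continuous functions is needed
because `α` is only integrable. -/
theorem integral_mul_primitive_pow {α : ℝ → ℝ} {s t : ℝ} (hα : IntervalIntegrable α volume s t)
    (k : ℕ) : ∫ τ in s..t, α τ * (∫ r in s..τ, α r) ^ k = (∫ r in s..t, α r) ^ (k + 1) / (k + 1) := by
  set P : ℝ → ℝ := fun τ => ∫ r in s..τ, α r with hP
  have hac : AbsolutelyContinuousOnInterval P s t :=
    hα.absolutelyContinuousOnInterval_intervalIntegral Set.left_mem_uIcc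
  have h := (AbsolutelyContinuousOnInterval.pow_succ hac k).integral_deriv_eq_sub
  have e : ∫ τ in s..t, deriv (P ^ (k + 1)) τ = ∫ τ in s..t, ((k : ℝ) + 1) * (α τ * P τ ^ k) := by
    refine intervalIntegral.integral_congr_ae ?_
    filter_upwards [hα.ae_hasDerivAt_integral] with τ h1 hτ
    have := ((h1 (Set.uIoc_subset_uIcc hτ) s Set.left_mem_uIcc).pow (k + 1)).deriv
    refine Eq.trans this ?_
    simp only [Nat.add_sub_cancel]
    push_cast
    ring
  rw [e, intervalIntegral.integral_const_mul] at h
  have hs : P s = 0 := by simp [hP]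
  simp only [Pi.pow_apply, hs] at h
  rw [eq_div_iff (by positivity), mul_comm, h]
  simp [hP]

/-- The absolute values cover both time directions: for `t < s` the primitive is nonpositive and
contributes a sign `(-1) ^ k`. -/
theorem abs_integral_mul_abs_primitive_pow {α : ℝ → ℝ} (hα0 : ∀ t, 0 ≤ α t) {s t : ℝ}
    (hα : IntervalIntegrable α volume s t) (k : ℕ) :
    |∫ τ in s..t, α τ * |∫ r in s..τ, α r| ^ k| = |∫ r in s..t, α r| ^ (k + 1) / (k + 1) := by
  have hk : (0 : ℝ) < k + 1 := by positivity
  have key := integral_mul_primitive_pow hα k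
  rcases le_total s t with hst | hts
  · have e : ∫ τ in s..t, α τ * |∫ r in s..τ, α r| ^ k =
        ∫ τ in s..t, α τ * (∫ r in s..τ, α r) ^ k := by
      refine intervalIntegral.integral_congr fun τ hτ => ?_
      rw [Set.uIcc_of_le hst] at hτ
      rw [abs_of_nonneg (intervalIntegral.integral_nonneg hτ.1 fun r _ => hα0 r)]
    rw [e, key, abs_div, abs_pow, abs_of_pos hk]
  · have e : ∫ τ in s..t, α τ * |∫ r in s..τ, α r| ^ k =
        (-1) ^ k * ∫ τ in s..t, α τ * (∫ r in s..τ, α r) ^ k := by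
      rw [← intervalIntegral.integral_const_mul]
      refine intervalIntegral.integral_congr fun τ hτ => ?_
      rw [Set.uIcc_of_ge hts] at hτ
      have : ∫ r in s..τ, α r ≤ 0 := by
        rw [intervalIntegral.integral_symm, neg_nonpos]
        exact intervalIntegral.integral_nonneg hτ.2 fun r _ => hα0 r
      rw [abs_of_nonpos this, neg_pow]
      ring
    rw [e, key, abs_mul, abs_div, abs_pow, abs_pow, abs_of_pos hk]
    simp

theorem locInt_mulVec {n k : ℕ} {T : Set ℝ} (hT' : T.OrdConnected)
    {A : ℝ → Matrix (Fin n) (Fin k) ℂ} (hA : ∀ i j, LocInt T fun t => A t i j)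
    {y : ℝ → Fin k → ℂ} (hy : ContinuousOn y T) : LocInt T fun t => A t *ᵥ y t := by
  intro s hs t ht
  have hyc := hy.mono (hT'.uIcc_subset hs ht)
  obtain ⟨R, hR⟩ := isCompact_uIcc.exists_bound_of_continuousOn hyc
  have hym : AEStronglyMeasurable y (volume.restrict (Set.uIoc s t)) :=
    (hyc.mono Set.uIoc_subset_uIcc).aestronglyMeasurable measurableSet_uIoc
  rw [intervalIntegrable_iff]
  refine integrable_mulVec (R := R) (fun i j => intervalIntegrable_iff.1 (hA i j s hs t ht)) hym ?_
  exact ae_restrict_of_forall_mem measurableSet_uIoc fun τ hτ => hR τ (Set.uIoc_subset_uIcc hτ)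

theorem LocInt.entryNorm {ι κ : Type*} [Fintype ι] [Fintype κ] {T : Set ℝ}
    {A : ℝ → Matrix ι κ ℂ} (hA : ∀ i j, LocInt T fun t => A t i j) :
    LocInt T fun t => entryNorm (A t) := fun s hs t ht => by
  rw [intervalIntegrable_iff]
  exact integrable_entryNorm fun i j => intervalIntegrable_iff.1 (hA i j s hs t ht)

/-- The terms of the Neumann series solving `ẋ = A x + b`, `x s = ξ`. -/
noncomputable def neumannTerm {n : ℕ} (A : ℝ → Matrix (Fin n) (Fin n) ℂ) (b : ℝ → Fin n → ℂ)
    (s : ℝ) (ξ : Fin n → ℂ) : ℕ → ℝ → Fin n → ℂ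
  | 0 => fun t => ξ + ∫ τ in s..t, b τ
  | k + 1 => fun t => ∫ τ in s..t, A τ *ᵥ neumannTerm A b s ξ k τ

theorem continuousOn_primitive {E : Type*} [NormedAddCommGroup E] [NormedSpace ℝ E]
    {T : Set ℝ} (hT : IsOpen T) {g : ℝ → E} (hg : LocInt T g) {s : ℝ} (hs : s ∈ T) :
    ContinuousOn (fun t => ∫ τ in s..t, g τ) T :=
  continuousOn_of_sub_eq_integral hT hg fun p hp q hq =>
    intervalIntegral.integral_interval_sub_left (hg s hs q hq) (hg s hs p hp)

theorem continuousOn_neumannTerm {n : ℕ} {T : Set ℝ} (hT : IsOpen T) (hT' : T.OrdConnected)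
    {A : ℝ → Matrix (Fin n) (Fin n) ℂ} (hA : ∀ i j, LocInt T fun t => A t i j)
    {b : ℝ → Fin n → ℂ} (hb : LocInt T b) {s : ℝ} (hs : s ∈ T) (ξ : Fin n → ℂ) (k : ℕ) :
    ContinuousOn (neumannTerm A b s ξ k) T := by
  induction k with
  | zero => exact continuousOn_const.add (continuousOn_primitive hT hb hs)
  | succ k ih => exact continuousOn_primitive hT (locInt_mulVec hT' hA ih) hs

/-- Each integration against `A` raises the power of the primitive of `entryNorm (A ·)` by one and
divides by `k + 1`, which produces the factorial of the exponential series. -/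
theorem norm_neumannTerm_le {n : ℕ} {T : Set ℝ} (hT : IsOpen T) (hT' : T.OrdConnected)
    {A : ℝ → Matrix (Fin n) (Fin n) ℂ} (hA : ∀ i j, LocInt T fun t => A t i j)
    {b : ℝ → Fin n → ℂ} {s : ℝ} (hs : s ∈ T) (ξ : Fin n → ℂ)
    {t : ℝ} (ht : t ∈ T) {M : ℝ} (hM : ∀ τ ∈ Set.uIcc s t, ‖neumannTerm A b s ξ 0 τ‖ ≤ M) (k : ℕ) :
    ∀ τ ∈ Set.uIcc s t,
      ‖neumannTerm A b s ξ k τ‖ ≤ M * (|∫ r in s..τ, entryNorm (A r)| ^ k / k.factorial) := by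
  have hαT : LocInt T fun t => entryNorm (A t) := LocInt.entryNorm hA
  induction k with
  | zero => intro τ hτ; simpa using hM τ hτ
  | succ k ih =>
    intro τ hτ
    have hτT := hT'.uIcc_subset hs ht hτ
    have hsub : Set.uIcc s τ ⊆ Set.uIcc s t := Set.uIcc_subset_uIcc_left hτ
    have hPc : ContinuousOn (fun p => |∫ r in s..p, entryNorm (A r)| ^ k) (Set.uIcc s τ) :=
      ((continuousOn_primitive hT hαT hs).mono (hT'.uIcc_subset hs hτT)).abs.pow k
    have hbi : IntervalIntegrable
        (fun p => entryNorm (A p) * |∫ r in s..p, entryNorm (A r)| ^ k) volume s τ :=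
      (hαT s hs τ hτT).mul_continuousOn hPc
    have h1 : ‖neumannTerm A b s ξ (k + 1) τ‖ ≤ |∫ p in s..τ, (M / k.factorial) *
        (entryNorm (A p) * |∫ r in s..p, entryNorm (A r)| ^ k)| := by
      refine intervalIntegral.norm_integral_le_abs_of_norm_le
        (ae_restrict_of_forall_mem measurableSet_uIoc fun p hp => ?_) (hbi.const_mul _)
      refine (norm_mulVec_le _ _).trans ?_
      have := ih p (hsub (Set.uIoc_subset_uIcc hp))
      calc entryNorm (A p) * ‖neumannTerm A b s ξ k p‖
          ≤ entryNorm (A p) * (M * (|∫ r in s..p, entryNorm (A r)| ^ k / k.factorial)) := by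
            have := entryNorm_nonneg (A p)
            gcongr
        _ = _ := by ring
    have hM0 : 0 ≤ M := (norm_nonneg _).trans (hM s Set.left_mem_uIcc)
    rw [intervalIntegral.integral_const_mul, abs_mul,
      abs_integral_mul_abs_primitive_pow (fun t => entryNorm_nonneg _) (hαT s hs τ hτT),
      abs_of_nonneg (by positivity)] at h1
    refine h1.trans (le_of_eq ?_)
    rw [Nat.factorial_succ]
    push_cast
    have : (k : ℝ) + 1 ≠ 0 := by positivity
    have : (k.factorial : ℝ) ≠ 0 := by positivity
    field_simp

/-- Carathéodory solutions of linear differential equations exist on the whole interval. -/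
theorem exists_linear_ode_solution {n : ℕ} {T : Set ℝ} (hT : IsOpen T) (hT' : T.OrdConnected)
    {A : ℝ → Matrix (Fin n) (Fin n) ℂ} (hA : ∀ i j, LocInt T fun t => A t i j)
    {b : ℝ → Fin n → ℂ} (hb : LocInt T b) {s : ℝ} (hs : s ∈ T) (ξ : Fin n → ℂ) :
    ∃ x : ℝ → Fin n → ℂ, x s = ξ ∧ LocInt T (fun t => A t *ᵥ x t + b t) ∧
      ∀ p ∈ T, ∀ q ∈ T, x q - x p = ∫ τ in p..q, (A τ *ᵥ x τ + b τ) := by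
  set w := neumannTerm A b s ξ with hw
  have hwc := continuousOn_neumannTerm hT hT' hA hb hs ξ
  have hαT : LocInt T fun t => entryNorm (A t) := LocInt.entryNorm hA
  -- A summable bound, uniform between `s` and `t`, gives both continuity of the sum and termwise
  -- integration.
  have hbound : ∀ t ∈ T, ∃ u : ℕ → ℝ, Summable u ∧ ∀ k, ∀ τ ∈ Set.uIcc s t, ‖w k τ‖ ≤ u k := by
    intro t ht
    have hsub := hT'.uIcc_subset hs ht
    obtain ⟨M, hM⟩ := isCompact_uIcc.exists_bound_of_continuousOn ((hwc 0).mono hsub)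
    obtain ⟨C, hC⟩ := isCompact_uIcc.exists_bound_of_continuousOn
      ((continuousOn_primitive hT hαT hs).mono hsub)
    have hM0 : 0 ≤ M := (norm_nonneg _).trans (hM s Set.left_mem_uIcc)
    refine ⟨fun k => M * (C ^ k / k.factorial),
      (Real.summable_pow_div_factorial C).mul_left M, fun k τ hτ => ?_⟩
    refine (norm_neumannTerm_le hT hT' hA hs ξ ht hM k τ hτ).trans ?_
    have := hC τ hτ
    rw [Real.norm_eq_abs] at this
    show _ ≤ M * (C ^ k / k.factorial)
    gcongr
  set x : ℝ → Fin n → ℂ := fun t => ∑' k, w k t with hx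
  have hxc : ∀ t ∈ T, ContinuousOn x (Set.uIcc s t) := fun t ht => by
    obtain ⟨u, hu, hle⟩ := hbound t ht
    exact continuousOn_tsum (fun k => (hwc k).mono (hT'.uIcc_subset hs ht)) hu hle
  have hsum : ∀ t ∈ T, ∀ τ ∈ Set.uIcc s t, HasSum (fun k => w k τ) (x τ) := fun t ht τ hτ => by
    obtain ⟨u, hu, hle⟩ := hbound t ht
    exact (Summable.of_norm_bounded hu fun k => hle k τ hτ).hasSum
  have hAx0 : ∀ t ∈ T, IntervalIntegrable (fun τ => A τ *ᵥ x τ) volume s t := by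
    intro t ht
    obtain ⟨R, hR⟩ := isCompact_uIcc.exists_bound_of_continuousOn (hxc t ht)
    rw [intervalIntegrable_iff]
    exact integrable_mulVec (R := R) (fun i j => intervalIntegrable_iff.1 (hA i j s hs t ht))
      (((hxc t ht).mono Set.uIoc_subset_uIcc).aestronglyMeasurable measurableSet_uIoc)
      (ae_restrict_of_forall_mem measurableSet_uIoc fun τ hτ => hR τ (Set.uIoc_subset_uIcc hτ))
  have hAx : LocInt T fun τ => A τ *ᵥ x τ := fun p hp q hq => (hAx0 p hp).symm.trans (hAx0 q hq)
  have hxt : ∀ t ∈ T, x t = ξ + ∫ τ in s..t, (A τ *ᵥ x τ + b τ) := by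
    intro t ht
    obtain ⟨u, hu, hle⟩ := hbound t ht
    have h1 : HasSum (fun k => w (k + 1) t) (∫ τ in s..t, A τ *ᵥ x τ) := by
      refine intervalIntegral.hasSum_integral_of_dominated_convergence
        (fun k τ => entryNorm (A τ) * u k) (fun k => ?_) (fun k => ?_) ?_ ?_ ?_
      · exact (intervalIntegrable_iff.1 (locInt_mulVec hT' hA (hwc k) s hs t ht)).1
      · refine ae_of_all _ fun τ hτ => (norm_mulVec_le _ _).trans ?_
        have := entryNorm_nonneg (A τ)
        have := hle k τ (Set.uIoc_subset_uIcc hτ)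
        gcongr
      · exact ae_of_all _ fun τ _ => hu.mul_left _
      · simp only [tsum_mul_left]
        exact (hαT s hs t ht).mul_const _
      · refine ae_of_all _ fun τ hτ => ?_
        exact (hsum t ht τ (Set.uIoc_subset_uIcc hτ)).mapL
          (Matrix.mulVecLin (A τ)).toContinuousLinearMap
    -- Splitting off the zeroth term leaves the shifted series, which `h1` identifies as the
    -- integral of `A x`.
    have h2 := (hsum t ht t Set.right_mem_uIcc).summable.tsum_eq_zero_add
    rw [h1.tsum_eq] at h2
    rw [intervalIntegral.integral_add (hAx s hs t ht) (hb s hs t ht), add_comm (∫ τ in s..t, _),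
      ← add_assoc]
    exact h2
  have hg : LocInt T fun τ => A τ *ᵥ x τ + b τ := fun p hp q hq => (hAx p hp q hq).add (hb p hp q hq)
  refine ⟨x, by simpa using hxt s hs, hg, fun p hp q hq => ?_⟩
  rw [hxt p hp, hxt q hq, add_sub_add_left_eq_sub,
    intervalIntegral.integral_interval_sub_left (hg s hs q hq) (hg s hs p hp)]


/-! ### Comparison of the dissipation inequality with the integral KYP inequality -/

theorem intervalIntegrable_sesq_matrix {ι κ : Type*} [Fintype ι] [Fintype κ] {a b : ℝ}
    {M : ℝ → Matrix ι κ ℂ} {x : ℝ → ι → ℂ} {y : ℝ → κ → ℂ}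
    (hM : ∀ i j, IntervalIntegrable (fun t => M t i j) volume a b)
    (hx : ContinuousOn x (Set.uIcc a b)) (hy : ContinuousOn y (Set.uIcc a b)) :
    IntervalIntegrable (fun t => sesq (M t) (x t) (y t)) volume a b := by
  obtain ⟨R, hR⟩ := isCompact_uIcc.exists_bound_of_continuousOn hx
  obtain ⟨R', hR'⟩ := isCompact_uIcc.exists_bound_of_continuousOn hy
  rw [intervalIntegrable_iff]
  refine integrable_sesq_of_matrix (R := max R R') (fun i j => intervalIntegrable_iff.1 (hM i j))
    ((hx.mono Set.uIoc_subset_uIcc).aestronglyMeasurable measurableSet_uIoc)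
    ((hy.mono Set.uIoc_subset_uIcc).aestronglyMeasurable measurableSet_uIoc)
    (ae_restrict_of_forall_mem measurableSet_uIoc fun t ht => ?_)
    (ae_restrict_of_forall_mem measurableSet_uIoc fun t ht => ?_)
  · exact (hR t (Set.uIoc_subset_uIcc ht)).trans (le_max_left _ _)
  · exact (hR' t (Set.uIoc_subset_uIcc ht)).trans (le_max_right _ _)

theorem intervalIntegrable_sesq_right {ι κ : Type*} [Fintype ι] [Fintype κ] {a b : ℝ}
    {M : ℝ → Matrix ι κ ℂ} {x : ℝ → ι → ℂ} {g : ℝ → κ → ℂ}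
    (hM : ∀ i j, AEStronglyMeasurable (fun t => M t i j) (volume.restrict (Set.uIoc a b)))
    {K : ℝ} (hK : ∀ t ∈ Set.uIcc a b, entryNorm (M t) ≤ K)
    (hx : ContinuousOn x (Set.uIcc a b)) (hg : IntervalIntegrable g volume a b) :
    IntervalIntegrable (fun t => sesq (M t) (x t) (g t)) volume a b := by
  obtain ⟨R, hR⟩ := isCompact_uIcc.exists_bound_of_continuousOn hx
  rw [intervalIntegrable_iff] at hg ⊢
  exact integrable_sesq_of_right (R := R) (K := K) hg hM
    ((hx.mono Set.uIoc_subset_uIcc).aestronglyMeasurable measurableSet_uIoc)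
    (ae_restrict_of_forall_mem measurableSet_uIoc fun t ht => hR t (Set.uIoc_subset_uIcc ht))
    (ae_restrict_of_forall_mem measurableSet_uIoc fun t ht => hK t (Set.uIoc_subset_uIcc ht))

/-- Over a short interval, the supply rate along a trajectory differs little from its value at the
frozen left endpoint. -/
theorem abs_local_difference_le {ι κ : Type*} [Fintype ι] [Fintype κ]
    {M : ℝ → Matrix κ κ ℂ} {Q : ℝ → Matrix ι ι ℂ} {s s' : ℝ} (hss : s ≤ s')
    {x g : ℝ → ι → ℂ} {z : ℝ → κ → ℂ} {ζ : κ → ℂ} {G : ℝ → ℝ} {K R V ε : ℝ} (hε : 0 ≤ ε)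
    (hM : ∀ i j, IntervalIntegrable (fun t => M t i j) volume s s')
    (hx : ContinuousOn x (Set.Icc s s')) (hz : ContinuousOn z (Set.Icc s s'))
    (hg : IntervalIntegrable g volume s s') (hxg : x s' - x s = ∫ t in s..s', g t)
    (hQm : ∀ i j, AEStronglyMeasurable (fun t => Q t i j) (volume.restrict (Set.uIoc s s')))
    (hQh : (Q s').IsHermitian) (hQK : ∀ t ∈ Set.Icc s s', entryNorm (Q t) ≤ K)
    (hQV : ∀ t ∈ Set.Icc s s', entryNorm (Q t - Q s') ≤ V)
    (hxR : ∀ t ∈ Set.Icc s s', ‖x t‖ ≤ R) (hzR : ∀ t ∈ Set.Icc s s', ‖z t‖ ≤ R) (hζR : ‖ζ‖ ≤ R)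
    (hxε : ∀ t ∈ Set.Icc s s', ‖x t - x s‖ ≤ ε) (hzε : ∀ t ∈ Set.Icc s s', ‖z t - ζ‖ ≤ ε)
    (hG : IntervalIntegrable G volume s s') (hgG : ∀ t ∈ Set.Icc s s', ‖g t‖ ≤ G t)
    (hGε : ∫ t in s..s', G t ≤ ε) :
    |(sesq (Q s) (x s) (x s) - sesq (Q s') (x s') (x s') +
        ∫ t in s..s', (2 * sesq (Q t) (x t) (g t) + sesq (M t) (z t) (z t))) -
      (sesq (Q s) (x s) (x s) - sesq (Q s') (x s) (x s) + ∫ t in s..s', sesq (M t) ζ ζ)| ≤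
      ε * (2 * R * V + 3 * K * (∫ t in s..s', G t) + 2 * R * ∫ t in s..s', entryNorm (M t)) := by
  have hu : Set.uIcc s s' = Set.Icc s s' := Set.uIcc_of_le hss
  have hsI : s ∈ Set.Icc s s' := ⟨le_rfl, hss⟩
  have hsI' : s' ∈ Set.Icc s s' := ⟨hss, le_rfl⟩
  have hR0 : 0 ≤ R := (norm_nonneg _).trans (hxR s hsI)
  have hK0 : 0 ≤ K := (entryNorm_nonneg _).trans (hQK s hsI)
  have hV0 : 0 ≤ V := (entryNorm_nonneg _).trans (hQV s hsI)
  have i1 : IntervalIntegrable (fun t => sesq (Q t) (x t) (g t)) volume s s' :=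
    intervalIntegrable_sesq_right hQm (by rwa [hu]) (by rwa [hu]) hg
  have i2 : IntervalIntegrable (fun t => sesq (M t) (z t) (z t)) volume s s' :=
    intervalIntegrable_sesq_matrix hM (by rwa [hu]) (by rwa [hu])
  have i3 : IntervalIntegrable (fun t => sesq (M t) ζ ζ) volume s s' :=
    intervalIntegrable_sesq_matrix hM continuousOn_const continuousOn_const
  have i4 : IntervalIntegrable (fun t => sesq (Q s') (x s' + x s) (g t)) volume s s' :=
    intervalIntegrable_sesq_right (K := K) (fun i j => aestronglyMeasurable_const)
      (fun _ _ => hQK s' hsI') continuousOn_const hg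
  have iM : IntervalIntegrable (fun t => entryNorm (M t)) volume s s' := by
    rw [intervalIntegrable_iff]
    exact integrable_entryNorm fun i j => intervalIntegrable_iff.1 (hM i j)
  -- With `Q` frozen at `s'`, the difference of squares factors for Hermitian `Q s'`, and `x s' - x
  -- s` is the integral of `g`. No product rule involving `Q` is used.
  have hquad : sesq (Q s') (x s') (x s') - sesq (Q s') (x s) (x s) =
      ∫ t in s..s', sesq (Q s') (x s' + x s) (g t) := by
    rw [← sesq_intervalIntegral_right _ _ hg, ← hxg, sesq_add_left, sesq_sub_right, sesq_sub_right,
      sesq_comm_of_isHermitian hQh (x s') (x s)]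
    ring
  have hsplit : (sesq (Q s) (x s) (x s) - sesq (Q s') (x s') (x s') +
        ∫ t in s..s', (2 * sesq (Q t) (x t) (g t) + sesq (M t) (z t) (z t))) -
      (sesq (Q s) (x s) (x s) - sesq (Q s') (x s) (x s) + ∫ t in s..s', sesq (M t) ζ ζ) =
      ∫ t in s..s', ((2 * sesq (Q t) (x t) (g t) - sesq (Q s') (x s' + x s) (g t)) +
        (sesq (M t) (z t) (z t) - sesq (M t) ζ ζ)) := by
    rw [intervalIntegral.integral_add ((i1.const_mul 2).sub i4) (i2.sub i3),
      intervalIntegral.integral_sub (i1.const_mul 2) i4, intervalIntegral.integral_sub i2 i3,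
      intervalIntegral.integral_add (i1.const_mul 2) i2, ← hquad]
    ring
  rw [hsplit, ← Real.norm_eq_abs]
  have hb : ‖∫ t in s..s', ((2 * sesq (Q t) (x t) (g t) - sesq (Q s') (x s' + x s) (g t)) +
        (sesq (M t) (z t) (z t) - sesq (M t) ζ ζ))‖ ≤
      ∫ t in s..s', ((2 * R * V + 3 * K * ε) * G t + 2 * R * ε * entryNorm (M t)) := by
    refine intervalIntegral.norm_integral_le_of_norm_le hss (ae_of_all _ fun t ht => ?_)
      ((hG.const_mul _).add (iM.const_mul _))
    have htI : t ∈ Set.Icc s s' := Set.Ioc_subset_Icc_self ht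
    -- After replacing `Q t` by `Q s'`, the left vector is `2 x(t) - x(s') - x(s)`. It is split
    -- through `x s`, so its parts are bounded by `2ε` and `ε`: hence the factor `3`.
    have e1 : 2 * sesq (Q t) (x t) (g t) - sesq (Q s') (x s' + x s) (g t) =
        2 * sesq (Q t - Q s') (x t) (g t) + sesq (Q s') ((x t - x s) - (x s' - x s)) (g t) +
          sesq (Q s') (x t - x s) (g t) := by
      simp only [sesq_sub_matrix, sesq_add_left, sesq_sub_left]
      ring
    have e2 : sesq (M t) (z t) (z t) - sesq (M t) ζ ζ =
        sesq (M t) (z t - ζ) (z t) + sesq (M t) ζ (z t - ζ) := by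
      simp only [sesq_sub_left, sesq_sub_right]
      ring
    have b1 : |sesq (Q t - Q s') (x t) (g t)| ≤ V * (R * G t) := by
      refine (abs_sesq_le _ _ _).trans ?_
      have := hQV t htI; have := hxR t htI; have := hgG t htI
      gcongr
    have b2 : |sesq (Q s') ((x t - x s) - (x s' - x s)) (g t)| ≤ K * ((ε + ε) * G t) := by
      refine (abs_sesq_le _ _ _).trans ?_
      have := hQK s' hsI'; have := hgG t htI
      have : ‖(x t - x s) - (x s' - x s)‖ ≤ ε + ε :=
        (norm_sub_le _ _).trans (add_le_add (hxε t htI) (hxε s' hsI'))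
      gcongr
    have b3 : |sesq (Q s') (x t - x s) (g t)| ≤ K * (ε * G t) := by
      refine (abs_sesq_le _ _ _).trans ?_
      have := hQK s' hsI'; have := hgG t htI; have := hxε t htI
      gcongr
    have b4 : |sesq (M t) (z t - ζ) (z t)| ≤ entryNorm (M t) * (ε * R) := by
      refine (abs_sesq_le _ _ _).trans ?_
      have := entryNorm_nonneg (M t); have := hzε t htI; have := hzR t htI
      gcongr
    have b5 : |sesq (M t) ζ (z t - ζ)| ≤ entryNorm (M t) * (R * ε) := by
      refine (abs_sesq_le _ _ _).trans ?_
      have := entryNorm_nonneg (M t); have := hzε t htI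
      gcongr
    rw [e1, e2, Real.norm_eq_abs]
    rw [abs_le] at b1 b2 b3 b4 b5 ⊢
    constructor <;> linarith
  refine hb.trans ?_
  rw [intervalIntegral.integral_add (hG.const_mul _) (iM.const_mul _),
    intervalIntegral.integral_const_mul, intervalIntegral.integral_const_mul]
  -- `V` need not be small because `Q` may jump; the smallness of this term comes from the integral
  -- of `G`.
  have : R * V * (∫ t in s..s', G t) ≤ R * V * ε := by gcongr
  linarith

/-- The KYP integrand: the Hermitian matrix of the form
`(x, u) ↦ 2 Re (yᴴ u) - 2 Re (xᴴ Q (A x + B u))` with `y = C x + D u`. -/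
noncomputable def kypIntegrand {T : Set ℝ} {n m : ℕ} (S : System T n m)
    (Q : ℝ → Matrix (Fin n) (Fin n) ℂ) (t : ℝ) : Matrix (Fin n ⊕ Fin m) (Fin n ⊕ Fin m) ℂ :=
  Matrix.fromBlocks (-((S.A t)ᴴ * Q t + Q t * S.A t)) ((S.C t)ᴴ - Q t * S.B t)
    (S.C t - (S.B t)ᴴ * Q t) (S.D t + (S.D t)ᴴ)

theorem sesq_fromBlocks {ι κ : Type*} [Fintype ι] [Fintype κ] (A : Matrix ι ι ℂ)
    (B : Matrix ι κ ℂ) (C : Matrix κ ι ℂ) (D : Matrix κ κ ℂ) (x x' : ι → ℂ) (u u' : κ → ℂ) :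
    sesq (Matrix.fromBlocks A B C D) (Sum.elim x u) (Sum.elim x' u') =
      sesq A x x' + sesq B x u' + (sesq C u x' + sesq D u u') := by
  simp only [sesq, Matrix.fromBlocks_mulVec, dotProduct, Fintype.sum_sum_type, Sum.elim_inl,
    Sum.elim_inr, Complex.add_re, Pi.add_apply, Pi.star_apply, mul_add, Finset.sum_add_distrib,
    Function.comp_def]

theorem sesq_mul {ι κ μ : Type*} [Fintype ι] [Fintype κ] [Fintype μ] (M : Matrix ι κ ℂ)
    (N : Matrix κ μ ℂ) (x : ι → ℂ) (y : μ → ℂ) : sesq (M * N) x y = sesq M x (N *ᵥ y) := by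
  simp [sesq, Matrix.mulVec_mulVec]

/-- The `A` and `B` terms of the integrand cancel `2 Re xᴴQẋ`, leaving only the supply rate from `C`
and `D`. Hermitian symmetry of `Q t` merges the adjoint pairs. -/
theorem sesq_kypIntegrand {T : Set ℝ} {n m : ℕ} (S : System T n m)
    {Q : ℝ → Matrix (Fin n) (Fin n) ℂ} {t : ℝ} (hQ : (Q t).IsHermitian) (x : Fin n → ℂ)
    (u : Fin m → ℂ) :
    2 * sesq (Q t) x (S.A t *ᵥ x + S.B t *ᵥ u) +
      sesq (kypIntegrand S Q t) (Sum.elim x u) (Sum.elim x u) =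
      2 * (star (S.C t *ᵥ x + S.D t *ᵥ u) ⬝ᵥ u).re := by
  have hy : (star (S.C t *ᵥ x + S.D t *ᵥ u) ⬝ᵥ u).re =
      sesq (S.C t)ᴴ x u + sesq (S.D t) u u := by
    rw [sesq_conjTranspose, sesq, sesq, ← Complex.add_re, ← dotProduct_add,
      Matrix.star_dotProduct]
    simp
  have h1 : sesq ((S.A t)ᴴ * Q t) x x = sesq (Q t) x (S.A t *ᵥ x) := by
    rw [← sesq_mul, ← sesq_conjTranspose (Q t * S.A t), Matrix.conjTranspose_mul, hQ.eq]
  have h2 : sesq ((S.B t)ᴴ * Q t) u x = sesq (Q t) x (S.B t *ᵥ u) := by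
    rw [← sesq_mul, ← sesq_conjTranspose (Q t * S.B t), Matrix.conjTranspose_mul, hQ.eq]
  have h3 : sesq (S.D t)ᴴ u u = sesq (S.D t) u u := sesq_conjTranspose _ _ _
  have h4 : sesq (S.C t)ᴴ x u = sesq (S.C t) u x := sesq_conjTranspose _ _ _
  rw [hy, kypIntegrand, sesq_fromBlocks, sesq_neg_matrix, sesq_add_matrix, sesq_sub_matrix,
    sesq_sub_matrix, sesq_add_matrix, sesq_add_right, h1, h2, h3, h4, sesq_mul, sesq_mul]
  ring


/-! ### Matrix functions of locally bounded variation -/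

theorem norm_entry_le_norm_toEuclideanCLM {n : ℕ} (M : Matrix (Fin n) (Fin n) ℂ) (i j : Fin n) :
    ‖M i j‖ ≤ ‖Matrix.toEuclideanCLM (n := Fin n) (𝕜 := ℂ) M‖ := by
  have h1 := (Matrix.toEuclideanCLM (n := Fin n) (𝕜 := ℂ) M).le_opNorm
    (EuclideanSpace.single j (1 : ℂ))
  have h2 := PiLp.norm_apply_le
    (Matrix.toEuclideanCLM (n := Fin n) (𝕜 := ℂ) M (EuclideanSpace.single j (1 : ℂ))) i
  have h3 : (Matrix.toEuclideanCLM (n := Fin n) (𝕜 := ℂ) M (EuclideanSpace.single j (1 : ℂ))) i =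
      M i j := by
    show (M *ᵥ (Pi.single j (1 : ℂ))) i = M i j
    simp
  rw [h3] at h2
  simpa using h2.trans h1

theorem entryNorm_le_norm_toEuclideanCLM {n : ℕ} (M : Matrix (Fin n) (Fin n) ℂ) :
    entryNorm M ≤ (n * n : ℝ) * ‖Matrix.toEuclideanCLM (n := Fin n) (𝕜 := ℂ) M‖ := by
  calc entryNorm M ≤ ∑ _i : Fin n, ∑ _j : Fin n,
      ‖Matrix.toEuclideanCLM (n := Fin n) (𝕜 := ℂ) M‖ :=
        Finset.sum_le_sum fun i _ => Finset.sum_le_sum fun j _ =>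
          norm_entry_le_norm_toEuclideanCLM M i j
    _ = _ := by simp [mul_assoc]

/-- The function `w` is the variation from a base point, scaled by `n * n` to pass from the operator
norm to the sum of entries. Its increments add over partitions. -/
theorem MatBVLoc.exists_variation_bound {n : ℕ} {T : Set ℝ} {Q : ℝ → Matrix (Fin n) (Fin n) ℂ}
    (hQ : MatBVLoc T Q) :
    ∃ w : ℝ → ℝ, ∀ s ∈ T, ∀ t ∈ T, s ≤ t → entryNorm (Q t - Q s) ≤ w t - w s := by
  rcases T.eq_empty_or_nonempty with rfl | ⟨c, hc⟩
  · exact ⟨0, by simp⟩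
  set q := fun t => Matrix.toEuclideanCLM (n := Fin n) (𝕜 := ℂ) (Q t) with hq
  refine ⟨fun t => (n * n : ℝ) * variationOnFromTo q T c t, fun s hs t ht hst => ?_⟩
  rw [← mul_sub, variationOnFromTo.sub_right hQ hc ht hs, variationOnFromTo.eq_of_le q T hst]
  refine (entryNorm_le_norm_toEuclideanCLM _).trans ?_
  gcongr
  rw [map_sub, ← dist_eq_norm, dist_edist]
  refine ENNReal.toReal_mono (hQ s t hs ht) ?_
  exact eVariationOn.edist_le q ⟨ht, hst, le_rfl⟩ ⟨hs, le_rfl, hst⟩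

/-- Jordan decomposition: `f + w` and `w` are both monotone on `T`, hence measurable. -/
theorem aestronglyMeasurable_of_variation_bound {f : ℝ → ℝ} {w : ℝ → ℝ} {T : Set ℝ}
    (hT : MeasurableSet T) (h : ∀ s ∈ T, ∀ t ∈ T, s ≤ t → |f t - f s| ≤ w t - w s) :
    AEStronglyMeasurable f (volume.restrict T) := by
  have h1 : MonotoneOn w T := fun s hs t ht hst => by
    have := (abs_nonneg _).trans (h s hs t ht hst); linarith
  have h2 : MonotoneOn (fun t => f t + w t) T := fun s hs t ht hst => by
    have := (abs_le.1 (h s hs t ht hst)).1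
    show f s + w s ≤ f t + w t
    linarith
  have := (aemeasurable_restrict_of_monotoneOn (μ := volume) hT h2).sub
    (aemeasurable_restrict_of_monotoneOn (μ := volume) hT h1)
  refine (this.congr (ae_of_all _ fun t => ?_)).aestronglyMeasurable
  simp

theorem MatBVLoc.aestronglyMeasurable {n : ℕ} {T : Set ℝ} {Q : ℝ → Matrix (Fin n) (Fin n) ℂ}
    (hT : MeasurableSet T) (hQ : MatBVLoc T Q) (i j : Fin n) :
    AEStronglyMeasurable (fun t => Q t i j) (volume.restrict T) := by
  obtain ⟨w, hw⟩ := hQ.exists_variation_bound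
  have hb : ∀ s ∈ T, ∀ t ∈ T, s ≤ t → ‖Q t i j - Q s i j‖ ≤ w t - w s := fun s hs t ht hst =>
    (norm_entry_le (Q t - Q s) i j).trans (hw s hs t ht hst)
  have hre := aestronglyMeasurable_of_variation_bound hT (f := fun t => (Q t i j).re) (w := w)
    fun s hs t ht hst => by
      rw [← Complex.sub_re]; exact (Complex.abs_re_le_norm _).trans (hb s hs t ht hst)
  have him := aestronglyMeasurable_of_variation_bound hT (f := fun t => (Q t i j).im) (w := w)
    fun s hs t ht hst => by
      rw [← Complex.sub_im]; exact (Complex.abs_im_le_norm _).trans (hb s hs t ht hst)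
  have := (Complex.continuous_ofReal.comp_aestronglyMeasurable hre).add
    ((Complex.continuous_ofReal.comp_aestronglyMeasurable him).mul_const Complex.I)
  refine this.congr (ae_of_all _ fun t => ?_)
  exact Complex.re_add_im _

theorem entryNorm_add_le {ι κ : Type*} [Fintype ι] [Fintype κ] (M N : Matrix ι κ ℂ) :
    entryNorm (M + N) ≤ entryNorm M + entryNorm N := by
  simp only [entryNorm, ← Finset.sum_add_distrib, Matrix.add_apply]
  exact Finset.sum_le_sum fun i _ => Finset.sum_le_sum fun j _ => norm_add_le _ _

theorem entryNorm_sub_comm {ι κ : Type*} [Fintype ι] [Fintype κ] (M N : Matrix ι κ ℂ) :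
    entryNorm (M - N) = entryNorm (N - M) := by
  simp only [entryNorm, Matrix.sub_apply, norm_sub_rev]

theorem MatBVLoc.exists_bound {n : ℕ} {T : Set ℝ} (hT' : T.OrdConnected)
    {Q : ℝ → Matrix (Fin n) (Fin n) ℂ} (hQ : MatBVLoc T Q) {a b : ℝ} (ha : a ∈ T) (hb : b ∈ T) :
    ∃ K, ∀ t ∈ Set.Icc a b, entryNorm (Q t) ≤ K := by
  obtain ⟨w, hw⟩ := hQ.exists_variation_bound
  refine ⟨entryNorm (Q a) + (w b - w a), fun t ht => ?_⟩
  have htT := hT'.out ha hb ht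
  have h1 := hw a ha t htT ht.1
  have h2 := (entryNorm_nonneg _).trans (hw t htT b hb ht.2)
  have h3 := entryNorm_add_le (Q a) (Q t - Q a)
  rw [add_sub_cancel] at h3
  linarith

/-! ### The quadratic form of the KYP matrix -/

section Kyp

variable {T : Set ℝ} {n m : ℕ}

theorem locInt_mul_of_bounded {f q : ℝ → ℂ} (hf : LocInt T f)
    (hqm : ∀ s ∈ T, ∀ t ∈ T, AEStronglyMeasurable q (volume.restrict (Set.uIoc s t)))
    (hq : ∀ s ∈ T, ∀ t ∈ T, ∃ K, ∀ r ∈ Set.uIcc s t, ‖q r‖ ≤ K) :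
    LocInt T fun t => q t * f t := fun s hs t ht => by
  obtain ⟨K, hK⟩ := hq s hs t ht
  have := hf s hs t ht
  rw [intervalIntegrable_iff] at this ⊢
  exact this.bdd_mul (hqm s hs t ht) (ae_restrict_of_forall_mem measurableSet_uIoc
    fun r hr => hK r (Set.uIoc_subset_uIcc hr))

theorem LocInt.star {f : ℝ → ℂ} (hf : LocInt T f) : LocInt T fun t => star (f t) :=
  fun s hs t ht => by
    have := hf s hs t ht
    rw [intervalIntegrable_iff] at this ⊢
    exact Complex.conjCLE.toContinuousLinearMap.integrable_comp this

theorem locInt_sum {α : Type*} (r : Finset α) {f : α → ℝ → ℂ} (hf : ∀ i ∈ r, LocInt T (f i)) :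
    LocInt T fun t => ∑ i ∈ r, f i t := fun s hs t ht => by
  simp only [intervalIntegrable_iff]
  exact integrable_finsetSum _ fun i hi => intervalIntegrable_iff.1 (hf i hi s hs t ht)

/-- Bounded variation makes `Q` measurable and bounded on compact intervals, so multiplying by it
preserves the local integrability of `A` and `B`. -/
theorem locInt_kypIntegrand (hT : MeasurableSet T) (hT' : T.OrdConnected) (S : System T n m)
    {Q : ℝ → Matrix (Fin n) (Fin n) ℂ} (hQ : MatBVLoc T Q) (i j : Fin n ⊕ Fin m) :
    LocInt T fun t => kypIntegrand S Q t i j := by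
  have hqm : ∀ i j, ∀ s ∈ T, ∀ t ∈ T,
      AEStronglyMeasurable (fun r => Q r i j) (volume.restrict (Set.uIoc s t)) :=
    fun i j s hs t ht => (hQ.aestronglyMeasurable hT i j).mono_measure (Measure.restrict_mono
      (Set.uIoc_subset_uIcc.trans (hT'.uIcc_subset hs ht)) le_rfl)
  have hq : ∀ i j, ∀ s ∈ T, ∀ t ∈ T, ∃ K, ∀ r ∈ Set.uIcc s t, ‖Q r i j‖ ≤ K := by
    intro i j s hs t ht
    have h1 : min s t ∈ T := by rcases min_choice s t with h | h <;> rw [h] <;> assumption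
    have h2 : max s t ∈ T := by rcases max_choice s t with h | h <;> rw [h] <;> assumption
    obtain ⟨K, hK⟩ := hQ.exists_bound hT' h1 h2
    exact ⟨K, fun r hr => (norm_entry_le _ i j).trans (hK r hr)⟩
  have hA : ∀ i j, LocInt T fun t => S.A t i j := fun i j => (S.memA i j).locInt hT' le_rfl
  have hB : ∀ i j, LocInt T fun t => S.B t i j := fun i j => (S.memB i j).locInt hT' (by norm_num)
  have hC : ∀ i j, LocInt T fun t => S.C t i j := fun i j => (S.memC i j).locInt hT' (by norm_num)
  have hD : ∀ i j, LocInt T fun t => S.D t i j := fun i j => (S.memD i j).locInt hT' le_top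
  rcases i with i | i <;> rcases j with j | j
  · have h1 : LocInt T fun t => ∑ k, Q t k j * star (S.A t k i) := locInt_sum _ fun k _ =>
      locInt_mul_of_bounded (hA k i).star (hqm k j) (hq k j)
    have h2 : LocInt T fun t => ∑ k, Q t i k * S.A t k j := locInt_sum _ fun k _ =>
      locInt_mul_of_bounded (hA k j) (hqm i k) (hq i k)
    intro s hs t ht
    refine ((h1 s hs t ht).add (h2 s hs t ht)).neg.congr fun r _ => ?_
    simp [kypIntegrand, Matrix.mul_apply, mul_comm]
  · have h1 : LocInt T fun t => ∑ k, Q t i k * S.B t k j := locInt_sum _ fun k _ =>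
      locInt_mul_of_bounded (hB k j) (hqm i k) (hq i k)
    intro s hs t ht
    refine (((hC j i).star s hs t ht).sub (h1 s hs t ht)).congr fun r _ => ?_
    simp [kypIntegrand, Matrix.mul_apply]
  · have h1 : LocInt T fun t => ∑ k, Q t k j * star (S.B t k i) := locInt_sum _ fun k _ =>
      locInt_mul_of_bounded (hB k i).star (hqm k j) (hq k j)
    intro s hs t ht
    refine ((hC i j s hs t ht).sub (h1 s hs t ht)).congr fun r _ => ?_
    simp [kypIntegrand, Matrix.mul_apply, mul_comm]
  · intro s hs t ht
    refine ((hD i j s hs t ht).add ((hD j i).star s hs t ht)).congr fun r _ => ?_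
    simp [kypIntegrand]

theorem isHermitian_kypIntegrand (S : System T n m) {Q : ℝ → Matrix (Fin n) (Fin n) ℂ} {t : ℝ}
    (hQ : (Q t).IsHermitian) : (kypIntegrand S Q t).IsHermitian := by
  refine Matrix.IsHermitian.fromBlocks ?_ ?_ ?_
  · simp [Matrix.IsHermitian, Matrix.conjTranspose_mul, hQ.eq, add_comm]
  · simp [Matrix.conjTranspose_mul, hQ.eq]
  · simp [Matrix.IsHermitian, add_comm]

/-- Separates the endpoint jump of `Q` from a single entrywise integral, so that quadratic forms can
be taken under the integral sign. -/
theorem kypMatrix_eq (S : System T n m) (Q : ℝ → Matrix (Fin n) (Fin n) ℂ) (t₀ t₁ : ℝ) :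
    kypMatrix S Q t₀ t₁ = Matrix.fromBlocks (Q t₀ - Q t₁) 0 0 0 +
      Matrix.of fun i j => ∫ t in t₀..t₁, kypIntegrand S Q t i j := by
  ext i j
  rcases i with i | i <;> rcases j with j | j
  · simp only [kypMatrix, kypIntegrand, matIntegral, Matrix.add_apply, Matrix.sub_apply,
      Matrix.neg_apply, Matrix.of_apply, Matrix.fromBlocks_apply₁₁,
      intervalIntegral.integral_neg]
    ring
  · simp [kypMatrix, kypIntegrand, matIntegral]
  · simp [kypMatrix, kypIntegrand, matIntegral]
  · simp [kypMatrix, kypIntegrand, matIntegral]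

theorem isHermitian_kypMatrix (hT' : T.OrdConnected) (S : System T n m)
    {Q : ℝ → Matrix (Fin n) (Fin n) ℂ} (hQ : ∀ t ∈ T, (Q t).IsHermitian) {t₀ t₁ : ℝ}
    (h₀ : t₀ ∈ T) (h₁ : t₁ ∈ T) : (kypMatrix S Q t₀ t₁).IsHermitian := by
  rw [kypMatrix_eq]
  refine Matrix.IsHermitian.add (Matrix.IsHermitian.fromBlocks ((hQ t₀ h₀).sub (hQ t₁ h₁))
    (by simp) (by simp [Matrix.IsHermitian])) ?_
  ext i j
  simp only [Matrix.conjTranspose_apply, Matrix.of_apply, Complex.star_def,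
    ← intervalIntegral.intervalIntegral_conj]
  refine intervalIntegral.integral_congr fun t ht => ?_
  exact (isHermitian_kypIntegrand S (hQ t (hT'.uIcc_subset h₀ h₁ ht))).apply i j

theorem sesq_kypMatrix (hT : MeasurableSet T) (hT' : T.OrdConnected) (S : System T n m)
    {Q : ℝ → Matrix (Fin n) (Fin n) ℂ} (hQ : MatBVLoc T Q) {t₀ t₁ : ℝ} (h₀ : t₀ ∈ T) (h₁ : t₁ ∈ T)
    (ξ : Fin n → ℂ) (η : Fin m → ℂ) :
    sesq (kypMatrix S Q t₀ t₁) (Sum.elim ξ η) (Sum.elim ξ η) =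
      sesq (Q t₀) ξ ξ - sesq (Q t₁) ξ ξ +
        ∫ t in t₀..t₁, sesq (kypIntegrand S Q t) (Sum.elim ξ η) (Sum.elim ξ η) := by
  rw [kypMatrix_eq, sesq_add_matrix, sesq_fromBlocks, sesq_sub_matrix,
    sesq_intervalIntegral_matrix fun i j => locInt_kypIntegrand hT hT' S hQ i j t₀ h₀ t₁ h₁]
  simp [sesq]

/-- The integral KYP inequality in terms of quadratic forms. -/
theorem integralKYP_iff (hT : MeasurableSet T) (hT' : T.OrdConnected) (S : System T n m)
    {Q : ℝ → Matrix (Fin n) (Fin n) ℂ} (hQ : MatBVLoc T Q) (hQh : ∀ t ∈ T, (Q t).IsHermitian) :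
    IntegralKYP S Q ↔ ∀ t₀ ∈ T, ∀ t₁ ∈ T, t₀ ≤ t₁ → ∀ (ξ : Fin n → ℂ) (η : Fin m → ℂ),
      0 ≤ sesq (Q t₀) ξ ξ - sesq (Q t₁) ξ ξ +
        ∫ t in t₀..t₁, sesq (kypIntegrand S Q t) (Sum.elim ξ η) (Sum.elim ξ η) := by
  constructor
  · intro h t₀ h₀ t₁ h₁ h01 ξ η
    rw [← sesq_kypMatrix hT hT' S hQ h₀ h₁]
    exact (Complex.le_def.1 ((h t₀ h₀ t₁ h₁ h01).dotProduct_mulVec_nonneg (Sum.elim ξ η))).1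
  · intro h t₀ h₀ t₁ h₁ h01
    have hH := isHermitian_kypMatrix hT' S hQh h₀ h₁
    refine Matrix.PosSemidef.of_dotProduct_mulVec_nonneg hH fun z => ?_
    have h1 := h t₀ h₀ t₁ h₁ h01 (z ∘ Sum.inl) (z ∘ Sum.inr)
    rw [← sesq_kypMatrix hT hT' S hQ h₀ h₁, Sum.elim_comp_inl_inr] at h1
    refine Complex.le_def.2 ⟨h1, ?_⟩
    have := hH.im_star_dotProduct_mulVec_self z
    simpa using this.symm

end Kyp


/-! ### Uniform estimates on short intervals. -/

theorem exists_delta_integral_le {f : ℝ → ℝ} {a b : ℝ} (hab : a ≤ b)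
    (hf : IntervalIntegrable f volume a b) {ε : ℝ} (hε : 0 < ε) :
    ∃ δ > 0, ∀ s s', a ≤ s → s ≤ s' → s' ≤ b → s' - s < δ → ∫ t in s..s', f t ≤ ε := by
  have hc := intervalIntegral.continuousOn_primitive_interval' hf Set.left_mem_uIcc
  rw [Set.uIcc_of_le hab] at hc
  have hu := isCompact_Icc.uniformContinuousOn_of_continuous hc
  obtain ⟨δ, hδ, H⟩ := Metric.uniformContinuousOn_iff_le.1 hu ε hε
  refine ⟨δ, hδ, fun s s' h1 h2 h3 h4 => ?_⟩
  have hs : s ∈ Set.Icc a b := ⟨h1, h2.trans h3⟩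
  have hs' : s' ∈ Set.Icc a b := ⟨h1.trans h2, h3⟩
  have := H s' hs' s hs (by rw [Real.dist_eq, abs_of_nonneg (by linarith)]; exact h4.le)
  rw [Real.dist_eq, intervalIntegral.integral_interval_sub_left
    (hf.mono_set (Set.uIcc_subset_uIcc_left (by rwa [Set.uIcc_of_le hab])))
    (hf.mono_set (Set.uIcc_subset_uIcc_left (by rwa [Set.uIcc_of_le hab])))] at this
  exact (le_abs_self _).trans this

theorem exists_delta_norm_sub_le {E : Type*} [NormedAddCommGroup E] {f : ℝ → E} {a b : ℝ}
    (hf : ContinuousOn f (Set.Icc a b)) {ε : ℝ} (hε : 0 < ε) :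
    ∃ δ > 0, ∀ s ∈ Set.Icc a b, ∀ t ∈ Set.Icc a b, |t - s| < δ → ‖f t - f s‖ ≤ ε := by
  have hu := isCompact_Icc.uniformContinuousOn_of_continuous hf
  obtain ⟨δ, hδ, H⟩ := Metric.uniformContinuousOn_iff_le.1 hu ε hε
  refine ⟨δ, hδ, fun s hs t ht h => ?_⟩
  rw [← dist_eq_norm]
  exact H t ht s hs (by rw [Real.dist_eq]; exact h.le)

theorem norm_sumElim_le {ι κ : Type*} [Fintype ι] [Fintype κ] {x : ι → ℂ} {u : κ → ℂ} {R : ℝ}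
    (hx : ‖x‖ ≤ R) (hu : ‖u‖ ≤ R) : ‖Sum.elim x u‖ ≤ R := by
  refine (pi_norm_le_iff_of_nonneg ((norm_nonneg _).trans hx)).2 fun i => ?_
  rcases i with i | i
  · exact (norm_le_pi_norm x i).trans hx
  · exact (norm_le_pi_norm u i).trans hu

theorem sumElim_sub_sumElim {ι κ : Type*} (x x' : ι → ℂ) (u u' : κ → ℂ) :
    Sum.elim x u - Sum.elim x' u' = Sum.elim (x - x') (u - u') := by
  ext i
  rcases i with i | i <;> rfl

theorem continuousOn_sumElim {ι κ : Type*} {s : Set ℝ} {x : ℝ → ι → ℂ} {u : ℝ → κ → ℂ}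
    (hx : ContinuousOn x s) (hu : ContinuousOn u s) :
    ContinuousOn (fun t => Sum.elim (x t) (u t)) s := by
  refine continuousOn_pi.2 fun i => ?_
  rcases i with i | i
  · exact (continuous_apply i).comp_continuousOn hx
  · exact (continuous_apply i).comp_continuousOn hu

variable {T : Set ℝ} {n m : ℕ}

/-- Takes the variation increment `W s' - W s` as the bound `V` in `abs_local_difference_le`; the
error becomes `ε` times the increment of one fixed function, as `le_of_local_increment` requires. -/
theorem abs_kyp_difference_le (hT : MeasurableSet T) (hT' : T.OrdConnected) (S : System T n m)
    {Q : ℝ → Matrix (Fin n) (Fin n) ℂ} (hQ : MatBVLoc T Q) (hQh : ∀ t ∈ T, (Q t).IsHermitian)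
    {W : ℝ → ℝ} (hW : ∀ s ∈ T, ∀ t ∈ T, s ≤ t → entryNorm (Q t - Q s) ≤ W t - W s)
    {a b : ℝ} (ha : a ∈ T) (hb : b ∈ T) {K : ℝ} (hK : ∀ t ∈ Set.Icc a b, entryNorm (Q t) ≤ K)
    {s s' : ℝ} (has : a ≤ s) (hss : s ≤ s') (hsb : s' ≤ b)
    {x g : ℝ → Fin n → ℂ} {v : ℝ → Fin m → ℂ} {η : Fin m → ℂ} {G : ℝ → ℝ} {R ε : ℝ} (hε : 0 ≤ ε)
    (hx : ContinuousOn x (Set.Icc s s')) (hv : ContinuousOn v (Set.Icc s s'))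
    (hg : IntervalIntegrable g volume s s') (hxg : x s' - x s = ∫ t in s..s', g t)
    (hxR : ∀ t ∈ Set.Icc s s', ‖x t‖ ≤ R) (hvR : ∀ t ∈ Set.Icc s s', ‖v t‖ ≤ R) (hηR : ‖η‖ ≤ R)
    (hxε : ∀ t ∈ Set.Icc s s', ‖x t - x s‖ ≤ ε) (hvε : ∀ t ∈ Set.Icc s s', ‖v t - η‖ ≤ ε)
    (hG : IntervalIntegrable G volume a b) (hgG : ∀ t ∈ Set.Icc s s', ‖g t‖ ≤ G t)
    (hGε : ∫ t in s..s', G t ≤ ε) :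
    |(sesq (Q s) (x s) (x s) - sesq (Q s') (x s') (x s') +
        ∫ t in s..s', (2 * sesq (Q t) (x t) (g t) +
          sesq (kypIntegrand S Q t) (Sum.elim (x t) (v t)) (Sum.elim (x t) (v t)))) -
      (sesq (Q s) (x s) (x s) - sesq (Q s') (x s) (x s) +
        ∫ t in s..s', sesq (kypIntegrand S Q t) (Sum.elim (x s) η) (Sum.elim (x s) η))| ≤
      ε * ((2 * R * W s' + 3 * K * (∫ t in a..s', G t) +
          2 * R * ∫ t in a..s', entryNorm (kypIntegrand S Q t)) -
        (2 * R * W s + 3 * K * (∫ t in a..s, G t) +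
          2 * R * ∫ t in a..s, entryNorm (kypIntegrand S Q t))) := by
  have hI : Set.Icc a b ⊆ T := hT'.out ha hb
  have hsT : s ∈ T := hI ⟨has, hss.trans hsb⟩
  have hsT' : s' ∈ T := hI ⟨has.trans hss, hsb⟩
  have hIs : Set.Icc s s' ⊆ Set.Icc a b := Set.Icc_subset_Icc has hsb
  have hu : Set.uIcc a b = Set.Icc a b := Set.uIcc_of_le (has.trans (hss.trans hsb))
  have hMe := LocInt.entryNorm (locInt_kypIntegrand hT hT' S hQ)
  have hGs : IntervalIntegrable G volume a s :=
    hG.mono_set (Set.uIcc_subset_uIcc_left (by rw [hu]; exact ⟨has, hss.trans hsb⟩))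
  have hGs' : IntervalIntegrable G volume a s' :=
    hG.mono_set (Set.uIcc_subset_uIcc_left (by rw [hu]; exact ⟨has.trans hss, hsb⟩))
  have key := abs_local_difference_le (M := kypIntegrand S Q) (Q := Q) (V := W s' - W s) (K := K)
    (z := fun t => Sum.elim (x t) (v t)) (ζ := Sum.elim (x s) η) hss hε
    (fun i j => locInt_kypIntegrand hT hT' S hQ i j s hsT s' hsT') hx
    (continuousOn_sumElim hx hv) hg hxg
    (fun i j => (hQ.aestronglyMeasurable hT i j).mono_measure (Measure.restrict_mono
      (Set.uIoc_subset_uIcc.trans (hT'.uIcc_subset hsT hsT')) le_rfl))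
    (hQh s' hsT') (fun t ht => hK t (hIs ht))
    (fun t ht => by
      rw [entryNorm_sub_comm]
      have h1 := hW t (hI (hIs ht)) s' hsT' ht.2
      have h2 := (entryNorm_nonneg _).trans (hW s hsT t (hI (hIs ht)) ht.1)
      linarith)
    hxR (fun t ht => norm_sumElim_le (hxR t ht) (hvR t ht))
    (norm_sumElim_le (hxR s ⟨le_rfl, hss⟩) hηR) hxε
    (fun t ht => by
      rw [sumElim_sub_sumElim]
      exact norm_sumElim_le (hxε t ht) (hvε t ht))
    (hGs.symm.trans hGs') hgG hGε
  refine key.trans (le_of_eq ?_)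
  rw [← intervalIntegral.integral_interval_sub_left hGs' hGs,
    ← intervalIntegral.integral_interval_sub_left (hMe a ha s' hsT') (hMe a ha s hsT)]
  ring

/-! ### From storage functions to the integral KYP inequality -/

theorem memLpLoc_const (p : ENNReal) (c : ℂ) : MemLpLoc T p fun _ => c := fun K _ hK => by
  have : IsFiniteMeasure (volume.restrict K) := ⟨by simpa using hK.measure_lt_top⟩
  exact memLp_const c

theorem MemLpLoc.mul_continuousOn {p : ENNReal} {f k : ℝ → ℂ} (hf : MemLpLoc T p f)
    (hk : ContinuousOn k T) : MemLpLoc T p fun t => f t * k t := fun K hKT hK => by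
  obtain ⟨C, hC⟩ := hK.exists_bound_of_continuousOn (hk.mono hKT)
  have hk' : MemLp k ⊤ (volume.restrict K) :=
    memLp_top_of_bound ((hk.mono hKT).aestronglyMeasurable hK.measurableSet) C
      (ae_restrict_of_forall_mem hK.measurableSet hC)
  exact hk'.mul' (hf K hKT hK)

theorem vecMemLpLoc_mulVec {k l : ℕ} {p : ENNReal} {F : ℝ → Matrix (Fin k) (Fin l) ℂ}
    (hF : MatMemLpLoc T p F) {y : ℝ → Fin l → ℂ} (hy : ContinuousOn y T) :
    VecMemLpLoc T p fun t => F t *ᵥ y t := fun i K hKT hK => by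
  have := memLp_finsetSum Finset.univ (f := fun j t => F t i j * y t j) fun j _ =>
    ((hF i j).mul_continuousOn ((continuous_apply j).comp_continuousOn hy)) K hKT hK
  exact this

/-- Through every state there is a solution with constant input. -/
theorem exists_isSolution_const_input (hT : IsOpen T) (hT' : T.OrdConnected) (S : System T n m)
    {s : ℝ} (hs : s ∈ T) (ξ : Fin n → ℂ) (η : Fin m → ℂ) :
    ∃ x : ℝ → Fin n → ℂ, x s = ξ ∧ ContinuousOn x T ∧
      LocInt T (fun t => S.A t *ᵥ x t + S.B t *ᵥ η) ∧
      (∀ p ∈ T, ∀ q ∈ T, x q - x p = ∫ τ in p..q, (S.A τ *ᵥ x τ + S.B τ *ᵥ η)) ∧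
      IsSolution S x (fun _ => η) fun t => S.C t *ᵥ x t + S.D t *ᵥ η := by
  obtain ⟨x, hxs, hg, hxg⟩ := exists_linear_ode_solution hT hT'
    (fun i j => (S.memA i j).locInt hT' le_rfl)
    (locInt_mulVec hT' (fun i j => (S.memB i j).locInt hT' (by norm_num))
      (continuousOn_const (c := η))) hs ξ
  obtain ⟨hxc, hw⟩ := (hasWeakDeriv_iff hT hT').2 ⟨hg, hxg⟩
  refine ⟨x, hxs, hxc, hg, hxg, hxc, ⟨_, hw⟩, fun i => memLpLoc_const 2 (η i), fun i => ?_, hw,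
    ae_of_all _ fun t => rfl⟩
  intro K hKT hK
  exact (vecMemLpLoc_mulVec S.memC hxc i K hKT hK).add
    (MemLpLoc.mono_exponent (vecMemLpLoc_mulVec S.memD (continuousOn_const (c := η)) i) le_top K
      hKT hK)

/-- Solutions with constant input stay close to their initial value over short intervals. -/
theorem norm_sub_le_of_ode {A : ℝ → Matrix (Fin n) (Fin n) ℂ} {B : ℝ → Matrix (Fin n) (Fin m) ℂ}
    {x : ℝ → Fin n → ℂ} {η : Fin m → ℂ} {s s' R κ : ℝ} (hss : s ≤ s')
    (hx : ContinuousOn x (Set.Icc s s'))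
    (hxg : ∀ t ∈ Set.Icc s s', x t - x s = ∫ τ in s..t, (A τ *ᵥ x τ + B τ *ᵥ η))
    (hint : IntervalIntegrable (fun t => entryNorm (A t) + entryNorm (B t)) volume s s')
    (hxs : ‖x s‖ ≤ R) (hη : ‖η‖ ≤ R)
    (hκ : ∫ t in s..s', (entryNorm (A t) + entryNorm (B t)) ≤ κ) (hκ2 : κ ≤ 1 / 2) :
    ∀ t ∈ Set.Icc s s', ‖x t - x s‖ ≤ 2 * κ * R := by
  -- In place of Gronwall: the maximal deviation `M` satisfies `M ≤ κ (R + M)`, and `κ ≤ 1 / 2`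
  -- allows `M` to be absorbed on the left.
  obtain ⟨p, hp, hmax⟩ := isCompact_Icc.exists_isMaxOn ⟨s, le_rfl, hss⟩
    (hx.sub (continuousOn_const (c := x s))).norm
  set M := ‖x p - x s‖ with hM
  have hMle : ∀ t ∈ Set.Icc s s', ‖x t - x s‖ ≤ M := fun t ht => hmax ht
  have hR0 : 0 ≤ R := (norm_nonneg _).trans hη
  have hM0 : 0 ≤ M := norm_nonneg _
  have hG0 : ∀ t, 0 ≤ entryNorm (A t) + entryNorm (B t) := fun t =>
    add_nonneg (entryNorm_nonneg _) (entryNorm_nonneg _)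
  have hint' : IntervalIntegrable (fun t => entryNorm (A t) + entryNorm (B t)) volume s p :=
    hint.mono_set (Set.uIcc_subset_uIcc_left (by rwa [Set.uIcc_of_le hss]))
  have h1 : M ≤ ∫ t in s..p, (entryNorm (A t) + entryNorm (B t)) * (R + M) := by
    have hM' : M = ‖∫ τ in s..p, (A τ *ᵥ x τ + B τ *ᵥ η)‖ := by rw [hM, hxg p hp]
    refine hM'.le.trans ?_
    refine intervalIntegral.norm_integral_le_of_norm_le hp.1 (ae_of_all _ fun t ht => ?_)
      (hint'.mul_const _)
    have htI : t ∈ Set.Icc s s' := ⟨ht.1.le, ht.2.trans hp.2⟩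
    have hxt : ‖x t‖ ≤ R + M := by
      have := norm_add_le (x s) (x t - x s)
      rw [add_sub_cancel] at this
      linarith [hMle t htI]
    calc ‖A t *ᵥ x t + B t *ᵥ η‖ ≤ entryNorm (A t) * ‖x t‖ + entryNorm (B t) * ‖η‖ :=
          (norm_add_le _ _).trans (add_le_add (norm_mulVec_le _ _) (norm_mulVec_le _ _))
      _ ≤ entryNorm (A t) * (R + M) + entryNorm (B t) * (R + M) := by
          have := entryNorm_nonneg (A t)
          have := entryNorm_nonneg (B t)
          gcongr
          linarith
      _ = _ := by ring
  have h2 : ∫ t in s..p, (entryNorm (A t) + entryNorm (B t)) ≤ κ :=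
    (intervalIntegral.integral_mono_interval le_rfl hp.1 hp.2 (ae_of_all _ hG0) hint).trans hκ
  rw [intervalIntegral.integral_mul_const] at h1
  have h3 : M ≤ κ * (R + M) := h1.trans (by gcongr)
  have h4 : M ≤ 2 * κ * R := by nlinarith
  exact fun t ht => (hMle t ht).trans h4

/-- The solution is restarted at `ξ` on every short interval, so it never drifts away from the
frozen state; each restart costs only the local comparison error. -/
theorem integralKYP_of_isStorageFunction (hT : IsOpen T) (hT' : T.OrdConnected)
    (S : System T n m) {Q : ℝ → Matrix (Fin n) (Fin n) ℂ} (hQ : MatBVLoc T Q)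
    (hQh : ∀ t ∈ T, (Q t).IsHermitian) (h : IsStorageFunction S (quadFun Q)) :
    IntegralKYP S Q := by
  rw [integralKYP_iff hT.measurableSet hT' S hQ hQh]
  intro a ha b hb hab ξ η
  have hI : Set.Icc a b ⊆ T := hT'.out ha hb
  obtain ⟨W, hW⟩ := hQ.exists_variation_bound
  obtain ⟨K, hK⟩ := hQ.exists_bound hT' ha hb
  have hK0 : 0 ≤ K := (entryNorm_nonneg _).trans (hK a ⟨le_rfl, hab⟩)
  have hMi := locInt_kypIntegrand hT.measurableSet hT' S hQ
  set Φ : ℝ → ℝ := fun t => sesq (kypIntegrand S Q t) (Sum.elim ξ η) (Sum.elim ξ η) with hΦ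
  have hΦi : LocInt T Φ := fun s hs t ht => intervalIntegrable_sesq_matrix
    (fun i j => hMi i j s hs t ht) continuousOn_const continuousOn_const
  have hG₀ : LocInt T fun t => entryNorm (S.A t) + entryNorm (S.B t) := fun s hs t ht =>
    ((LocInt.entryNorm fun i j => (S.memA i j).locInt hT' le_rfl) s hs t ht).add
      ((LocInt.entryNorm fun i j => (S.memB i j).locInt hT' (by norm_num)) s hs t ht)
  -- The extra `1` leaves room for the deviation `ε' ≤ 1` of the state from `ξ`.
  set R : ℝ := ‖ξ‖ + ‖η‖ + 1 with hR
  have hR1 : 1 ≤ R := by have := norm_nonneg ξ; have := norm_nonneg η; linarith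
  set G : ℝ → ℝ := fun t => (entryNorm (S.A t) + entryNorm (S.B t)) * R with hG
  have hGi : IntervalIntegrable G volume a b := (hG₀ a ha b hb).mul_const R
  have hMe := LocInt.entryNorm hMi
  suffices hmono : -sesq (Q a) ξ ξ + ∫ t in a..a, Φ t ≤ -sesq (Q b) ξ ξ + ∫ t in a..b, Φ t by
    rw [intervalIntegral.integral_same] at hmono
    linarith
  refine le_of_local_increment (φ := fun t => -sesq (Q t) ξ ξ + ∫ τ in a..t, Φ τ)
    (w := fun r => 2 * R * W r + 3 * K * (∫ t in a..r, G t) +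
          2 * R * ∫ t in a..r, entryNorm (kypIntegrand S Q t)) hab fun ε hε => ?_
  set ε' := min ε 1 with hε'
  have hε'0 : 0 < ε' := lt_min hε one_pos
  -- This `κ` makes the deviation bound `2 * κ * R` equal to `ε'`, and `κ ≤ 1 / 2` because `ε' ≤ 1 ≤
  -- R`.
  have hκ0 : 0 < ε' / (2 * R) := by positivity
  obtain ⟨δ, hδ, H⟩ := exists_delta_integral_le hab (hG₀ a ha b hb) hκ0
  refine ⟨δ, hδ, fun s s' has hss hsb hlt => ?_⟩
  have hsT : s ∈ T := hI ⟨has, hss.trans hsb⟩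
  have hsT' : s' ∈ T := hI ⟨has.trans hss, hsb⟩
  have hIs : Set.Icc s s' ⊆ T := hT'.out hsT hsT'
  have hκ := H s s' has hss hsb hlt
  obtain ⟨x, hxs, hxc, hg, hxg, hsol⟩ := exists_isSolution_const_input hT hT' S hsT ξ η
  have hclose := norm_sub_le_of_ode (R := R) hss (hxc.mono hIs)
    (fun t ht => hxg s hsT t (hIs ht)) (hG₀ s hsT s' hsT')
    (by rw [hxs]; have := norm_nonneg η; linarith) (by have := norm_nonneg ξ; linarith) hκ
    (by rw [div_le_iff₀ (by positivity)]
        have : ε' ≤ 1 := min_le_right _ _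
        linarith)
  have e0 : 2 * (ε' / (2 * R)) * R = ε' := by field_simp
  rw [e0] at hclose
  have hxR : ∀ t ∈ Set.Icc s s', ‖x t‖ ≤ R := fun t ht => by
    have h1 := norm_add_le (x s) (x t - x s)
    rw [add_sub_cancel, hxs] at h1
    have h2 := hclose t ht
    rw [hxs] at h2
    have : ε' ≤ 1 := min_le_right _ _
    have := norm_nonneg η
    linarith
  have hηR : ‖η‖ ≤ R := by have := norm_nonneg ξ; linarith
  have key := abs_kyp_difference_le hT.measurableSet hT' S hQ hQh hW ha hb hK has hss hsb
    (v := fun _ => η) (η := η) (G := G) (R := R) hε'0.le (hxc.mono hIs) continuousOn_const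
    (hg s hsT s' hsT') (hxg s hsT s' hsT') hxR (fun _ _ => hηR) hηR hclose
    (fun _ _ => by simpa using hε'0.le) hGi
    (fun t ht => by
      calc ‖S.A t *ᵥ x t + S.B t *ᵥ η‖ ≤ entryNorm (S.A t) * ‖x t‖ + entryNorm (S.B t) * ‖η‖ :=
            (norm_add_le _ _).trans (add_le_add (norm_mulVec_le _ _) (norm_mulVec_le _ _))
        _ ≤ entryNorm (S.A t) * R + entryNorm (S.B t) * R := by
            have := entryNorm_nonneg (S.A t)
            have := entryNorm_nonneg (S.B t)
            have := hxR t ht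
            gcongr
        _ = _ := by rw [hG]; ring)
    (by
      simp only [hG]
      rw [intervalIntegral.integral_mul_const]
      calc (∫ t in s..s', (entryNorm (S.A t) + entryNorm (S.B t))) * R ≤ ε' / (2 * R) * R := by
            gcongr
        _ = ε' / 2 := by field_simp
        _ ≤ ε' := by linarith)
  have hdis := h.dissipation x _ _ hsol s hsT s' hsT' hss
  have hrate : ∫ t in s..s', (2 * sesq (Q t) (x t) (S.A t *ᵥ x t + S.B t *ᵥ η) +
      sesq (kypIntegrand S Q t) (Sum.elim (x t) η) (Sum.elim (x t) η)) =
      2 * ∫ t in s..s', (star (S.C t *ᵥ x t + S.D t *ᵥ η) ⬝ᵥ η).re := by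
    rw [← intervalIntegral.integral_const_mul]
    refine intervalIntegral.integral_congr fun t ht => ?_
    rw [Set.uIcc_of_le hss] at ht
    exact sesq_kypIntegrand S (hQh t (hIs ht)) (x t) η
  rw [hrate] at key
  have hq : ∀ t z, quadFun Q t z = 1 / 2 * sesq (Q t) z z := fun t z => rfl
  simp only [hq] at hdis
  have hΦs : (∫ t in a..s', Φ t) - ∫ t in a..s, Φ t = ∫ t in s..s', Φ t :=
    intervalIntegral.integral_interval_sub_left (hΦi a ha s' hsT') (hΦi a ha s hsT)
  -- Passing from `ε'` to `ε` needs a nonnegative increment; this follows because `ε'` times it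
  -- dominates an absolute value.
  have hinc : ε' * ((2 * R * W s' + 3 * K * (∫ t in a..s', G t) +
          2 * R * ∫ t in a..s', entryNorm (kypIntegrand S Q t)) -
        (2 * R * W s + 3 * K * (∫ t in a..s, G t) +
          2 * R * ∫ t in a..s, entryNorm (kypIntegrand S Q t))) ≤
      ε * ((2 * R * W s' + 3 * K * (∫ t in a..s', G t) +
          2 * R * ∫ t in a..s', entryNorm (kypIntegrand S Q t)) -
        (2 * R * W s + 3 * K * (∫ t in a..s, G t) +
          2 * R * ∫ t in a..s, entryNorm (kypIntegrand S Q t))) :=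
    mul_le_mul_of_nonneg_right (min_le_left _ _)
      (nonneg_of_mul_nonneg_right ((abs_nonneg _).trans key) hε'0)
  have hk := (abs_le.1 key).2
  rw [hxs] at hk hdis
  simp only [hΦ] at hΦs ⊢
  linarith


/-! ### From the integral KYP inequality to storage functions -/

/-- The integrated KYP inequality along a trajectory, with the input replaced by a continuous
function. -/
theorem kyp_along_trajectory (hT : IsOpen T) (hT' : T.OrdConnected) (S : System T n m)
    {Q : ℝ → Matrix (Fin n) (Fin n) ℂ} (hQ : MatBVLoc T Q) (hQh : ∀ t ∈ T, (Q t).IsHermitian)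
    (h : IntegralKYP S Q) {a b : ℝ} (ha : a ∈ T) (hb : b ∈ T) (hab : a ≤ b)
    {x g : ℝ → Fin n → ℂ} {v : ℝ → Fin m → ℂ} (hx : ContinuousOn x (Set.Icc a b))
    (hv : ContinuousOn v (Set.Icc a b)) (hg : IntervalIntegrable g volume a b)
    (hxg : ∀ s ∈ Set.Icc a b, ∀ t ∈ Set.Icc a b, x t - x s = ∫ τ in s..t, g τ) :
    0 ≤ sesq (Q a) (x a) (x a) - sesq (Q b) (x b) (x b) +
        ∫ t in a..b, (2 * sesq (Q t) (x t) (g t) +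
          sesq (kypIntegrand S Q t) (Sum.elim (x t) (v t)) (Sum.elim (x t) (v t))) := by
  rw [integralKYP_iff hT.measurableSet hT' S hQ hQh] at h
  have hI : Set.Icc a b ⊆ T := hT'.out ha hb
  have hu : Set.uIcc a b = Set.Icc a b := Set.uIcc_of_le hab
  obtain ⟨W, hW⟩ := hQ.exists_variation_bound
  obtain ⟨K, hK⟩ := hQ.exists_bound hT' ha hb
  have hMi := locInt_kypIntegrand hT.measurableSet hT' S hQ
  obtain ⟨R₁, hR₁⟩ := isCompact_Icc.exists_bound_of_continuousOn hx
  obtain ⟨R₂, hR₂⟩ := isCompact_Icc.exists_bound_of_continuousOn hv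
  set R := max R₁ R₂ with hR
  have hxR : ∀ t ∈ Set.Icc a b, ‖x t‖ ≤ R := fun t ht => (hR₁ t ht).trans (le_max_left _ _)
  have hvR : ∀ t ∈ Set.Icc a b, ‖v t‖ ≤ R := fun t ht => (hR₂ t ht).trans (le_max_right _ _)
  set Φ : ℝ → ℝ := fun t => 2 * sesq (Q t) (x t) (g t) +
    sesq (kypIntegrand S Q t) (Sum.elim (x t) (v t)) (Sum.elim (x t) (v t)) with hΦ
  have hz := continuousOn_sumElim hx hv
  have hΦi : IntervalIntegrable Φ volume a b := by
    refine IntervalIntegrable.add (IntervalIntegrable.const_mul ?_ 2) ?_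
    · refine intervalIntegrable_sesq_right (fun i j => ?_) (by rwa [hu]) (by rwa [hu]) hg
      exact (hQ.aestronglyMeasurable hT.measurableSet i j).mono_measure (Measure.restrict_mono
        (Set.uIoc_subset_uIcc.trans (hT'.uIcc_subset ha hb)) le_rfl)
    · exact intervalIntegrable_sesq_matrix (fun i j => hMi i j a ha b hb) (by rwa [hu])
        (by rwa [hu])
  suffices hmono : -sesq (Q a) (x a) (x a) + ∫ t in a..a, Φ t ≤
      -sesq (Q b) (x b) (x b) + ∫ t in a..b, Φ t by
    rw [intervalIntegral.integral_same] at hmono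
    linarith
  refine le_of_local_increment (φ := fun t => -sesq (Q t) (x t) (x t) + ∫ τ in a..t, Φ τ)
    (w := fun r => 2 * R * W r + 3 * K * (∫ t in a..r, ‖g t‖) +
          2 * R * ∫ t in a..r, entryNorm (kypIntegrand S Q t)) hab fun ε hε => ?_
  obtain ⟨δ₁, hδ₁, H₁⟩ := exists_delta_integral_le hab hg.norm hε
  obtain ⟨δ₂, hδ₂, H₂⟩ := exists_delta_norm_sub_le hx hε
  obtain ⟨δ₃, hδ₃, H₃⟩ := exists_delta_norm_sub_le hv hε
  refine ⟨min δ₁ (min δ₂ δ₃), by positivity, fun s s' has hss hsb hlt => ?_⟩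
  rw [lt_min_iff, lt_min_iff] at hlt
  have hsI : s ∈ Set.Icc a b := ⟨has, hss.trans hsb⟩
  have hsI' : s' ∈ Set.Icc a b := ⟨has.trans hss, hsb⟩
  have hIs : Set.Icc s s' ⊆ Set.Icc a b := Set.Icc_subset_Icc has hsb
  have hd : ∀ t ∈ Set.Icc s s', |t - s| ≤ s' - s := fun t ht => by
    rw [abs_of_nonneg (by linarith [ht.1])]; linarith [ht.2]
  have ias : IntervalIntegrable Φ volume a s :=
    hΦi.mono_set (Set.uIcc_subset_uIcc_left (by rwa [hu]))
  have ias' : IntervalIntegrable Φ volume a s' :=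
    hΦi.mono_set (Set.uIcc_subset_uIcc_left (by rwa [hu]))
  have hgs : IntervalIntegrable g volume s s' :=
    hg.mono_set (by rw [hu, Set.uIcc_of_le hss]; exact hIs)
  have key := abs_kyp_difference_le hT.measurableSet hT' S hQ hQh hW ha hb hK has hss hsb
    (v := v) (η := v s) (G := fun t => ‖g t‖) (R := R) hε.le (hx.mono hIs) (hv.mono hIs) hgs
    (hxg s hsI s' hsI') (fun t ht => hxR t (hIs ht)) (fun t ht => hvR t (hIs ht)) (hvR s hsI)
    (fun t ht => H₂ s hsI t (hIs ht) ((hd t ht).trans_lt hlt.2.1))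
    (fun t ht => H₃ s hsI t (hIs ht) ((hd t ht).trans_lt hlt.2.2))
    hg.norm (fun _ _ => le_rfl) (H₁ s s' has hss hsb hlt.1)
  -- KYP is applied at the trajectory's values at the left endpoint, a different constant vector on
  -- each short interval.
  have hpos := h s (hI hsI) s' (hI hsI') hss (x s) (v s)
  have hΦs : (∫ t in a..s', Φ t) - ∫ t in a..s, Φ t = ∫ t in s..s', Φ t :=
    intervalIntegral.integral_interval_sub_left ias' ias
  have hk := (abs_le.1 key).1
  simp only [hΦ] at hΦs ⊢
  linarith

/-- The effect of perturbing the input on the KYP integrand. -/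
theorem kypIntegrand_perturbation_le (S : System T n m) {Q : ℝ → Matrix (Fin n) (Fin n) ℂ} {t : ℝ}
    (hQ : (Q t).IsHermitian) {x : Fin n → ℂ} (u v : Fin m → ℂ) {K R D : ℝ}
    (hK : entryNorm (Q t) ≤ K) (hR : ‖x‖ ≤ R) (hD : entryNorm (S.D t) ≤ D) :
    2 * sesq (Q t) x (S.A t *ᵥ x + S.B t *ᵥ u) +
        sesq (kypIntegrand S Q t) (Sum.elim x v) (Sum.elim x v) ≤
      2 * (star (S.C t *ᵥ x + S.D t *ᵥ u) ⬝ᵥ u).re +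
        (2 * R * (K * entryNorm (S.B t) + entryNorm (S.C t)) + 4 * D * ‖u‖) * ‖u - v‖ +
        2 * D * ‖u - v‖ ^ 2 := by
  have hy : ∀ w : Fin m → ℂ, (star (S.C t *ᵥ x + S.D t *ᵥ w) ⬝ᵥ w).re =
      sesq (S.C t) w x + sesq (S.D t) w w := fun w => by
    rw [sesq, sesq, ← Complex.add_re, ← dotProduct_add, Matrix.star_dotProduct]
    simp
  have h1 := sesq_kypIntegrand S hQ x v
  rw [hy] at h1
  rw [hy]
  -- The state derivative contains `u` while the form contains `v`: the exact identity is used for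
  -- `v`, and every remaining term is expanded in `u - v`.
  have e1 : sesq (Q t) x (S.A t *ᵥ x + S.B t *ᵥ u) =
      sesq (Q t) x (S.A t *ᵥ x + S.B t *ᵥ v) + sesq (Q t) x (S.B t *ᵥ (u - v)) := by
    rw [← sesq_add_right, Matrix.mulVec_sub]
    congr 1
    abel
  have e2 : sesq (S.C t) v x = sesq (S.C t) u x - sesq (S.C t) (u - v) x := by
    rw [sesq_sub_left]; ring
  have e3 : sesq (S.D t) v v = sesq (S.D t) u u - sesq (S.D t) u (u - v) -
      sesq (S.D t) (u - v) u + sesq (S.D t) (u - v) (u - v) := by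
    simp only [sesq_sub_left, sesq_sub_right]; ring
  have hB0 := entryNorm_nonneg (S.B t)
  have hC0 := entryNorm_nonneg (S.C t)
  have hK0 := (entryNorm_nonneg _).trans hK
  have hD0 := (entryNorm_nonneg _).trans hD
  have hR0 := (norm_nonneg _).trans hR
  have b1 : |sesq (Q t) x (S.B t *ᵥ (u - v))| ≤ K * (R * (entryNorm (S.B t) * ‖u - v‖)) := by
    refine (abs_sesq_le _ _ _).trans ?_
    have := norm_mulVec_le (S.B t) (u - v)
    gcongr
  have b2 : |sesq (S.C t) (u - v) x| ≤ entryNorm (S.C t) * (‖u - v‖ * R) := by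
    refine (abs_sesq_le _ _ _).trans ?_
    gcongr
  have b3 : |sesq (S.D t) u (u - v)| ≤ D * (‖u‖ * ‖u - v‖) := by
    refine (abs_sesq_le _ _ _).trans ?_
    gcongr
  have b4 : |sesq (S.D t) (u - v) u| ≤ D * (‖u - v‖ * ‖u‖) := by
    refine (abs_sesq_le _ _ _).trans ?_
    gcongr
  have b5 : |sesq (S.D t) (u - v) (u - v)| ≤ D * (‖u - v‖ * ‖u - v‖) := by
    refine (abs_sesq_le _ _ _).trans ?_
    gcongr
  rw [abs_le] at b1 b2 b3 b4 b5
  rw [e2, e3] at h1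
  rw [e1]
  nlinarith [b1.2, b2.1, b3.1, b4.1, b5.2]

theorem memLp_entryNorm {ι κ : Type*} [Fintype ι] [Fintype κ] {μ : Measure ℝ} {p : ENNReal}
    {M : ℝ → Matrix ι κ ℂ} (h : ∀ i j, MemLp (fun t => M t i j) p μ) :
    MemLp (fun t => entryNorm (M t)) p μ :=
  memLp_finsetSum _ fun i _ => memLp_finsetSum _ fun j _ => (h i j).norm

theorem exists_ae_bound_of_memLp_top {μ : Measure ℝ} {f : ℝ → ℝ} (h : MemLp f ⊤ μ) :
    ∃ D, ∀ᵐ t ∂μ, f t ≤ D := by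
  refine ⟨(eLpNormEssSup f μ).toReal, ?_⟩
  have hfin : eLpNormEssSup f μ ≠ ⊤ := by simpa [eLpNorm_exponent_top] using h.2.ne
  filter_upwards [ae_le_eLpNormEssSup (f := f) (μ := μ)] with t ht
  have := ENNReal.toReal_mono hfin ht
  rw [toReal_enorm] at this
  exact (le_abs_self _).trans this

/-- Continuous inputs are dense in `L²`. The state is kept as it is, so no continuous dependence of
solutions on the input is needed. -/
theorem isStorageFunction_of_integralKYP (hT : IsOpen T) (hT' : T.OrdConnected)
    (S : System T n m) {Q : ℝ → Matrix (Fin n) (Fin n) ℂ} (hQ : MatBVLoc T Q)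
    (hQp : ∀ t ∈ T, (Q t).PosSemidef) (h : IntegralKYP S Q) :
    IsStorageFunction S (quadFun Q) := by
  have hQh : ∀ t ∈ T, (Q t).IsHermitian := fun t ht => (hQp t ht).isHermitian
  refine ⟨fun t ht x => ?_, fun t _ => by simp [quadFun], fun x u y hsol a ha b hb hab => ?_⟩
  · exact mul_nonneg (by norm_num)
      (Complex.le_def.1 ((hQp t ht).dotProduct_mulVec_nonneg x)).1
  obtain ⟨hg, hxg⟩ := (hasWeakDeriv_iff hT hT').1 ⟨hsol.continuousOn, hsol.state_eq⟩
  have hI : Set.Icc a b ⊆ T := hT'.out ha hb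
  have hu : Set.uIoc a b = Set.Ioc a b := Set.uIoc_of_le hab
  have hIoc : Set.Ioc a b ⊆ T := Set.Ioc_subset_Icc_self.trans hI
  set μ := volume.restrict (Set.Ioc a b) with hμ
  have hLp : ∀ {p : ENNReal} {f : ℝ → ℂ}, MemLpLoc T p f → MemLp f p μ := fun hf => by
    have := hf.memLp_uIcc hT' ha hb
    rwa [hu] at this
  have hxc : ContinuousOn x (Set.Icc a b) := hsol.continuousOn.mono hI
  obtain ⟨R, hR⟩ := isCompact_Icc.exists_bound_of_continuousOn hxc
  obtain ⟨K, hK⟩ := hQ.exists_bound hT' ha hb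
  obtain ⟨D, hD⟩ := exists_ae_bound_of_memLp_top
    (memLp_entryNorm fun i j => hLp (S.memD i j))
  have huL : MemLp u 2 μ := MemLp.of_eval fun i => hLp (hsol.memInput i)
  have hyu : Integrable (fun t => (star (y t) ⬝ᵥ u t).re) μ := by
    have : Integrable (fun t => star (y t) ⬝ᵥ u t) μ := by
      refine integrable_finsetSum _ fun i _ => ?_
      exact (hLp (hsol.memOutput i)).star.integrable_mul (hLp (hsol.memInput i))
    exact Complex.reCLM.integrable_comp this
  -- The coefficient of `‖u - v‖` in the perturbation bound; it is in `L²` because `B`, `C` and `u`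
  -- are and `D` is essentially bounded.
  set N : ℝ → ℝ := fun t =>
    2 * R * (K * entryNorm (S.B t) + entryNorm (S.C t)) + 4 * D * ‖u t‖ with hN
  have hNL : MemLp N 2 μ :=
    ((((memLp_entryNorm fun i j => hLp (S.memB i j)).const_mul K).add
      (memLp_entryNorm fun i j => hLp (S.memC i j))).const_mul (2 * R)).add
      (huL.norm.const_mul (4 * D))
  have hN2 : Integrable (fun t => N t ^ 2) μ := hNL.integrable_sq
  -- For `a = b` the measure is zero and the essential bound `D` could be negative.
  rcases hab.eq_or_lt with rfl | hlt
  · simp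
  have hD0 : 0 ≤ D := by
    have : (ae μ).NeBot := by
      rw [ae_neBot, hμ, Ne, Measure.restrict_eq_zero]
      simpa using hlt
    obtain ⟨t, ht⟩ := hD.exists
    exact (entryNorm_nonneg _).trans ht
  -- `η` is the weight in Young's inequality for `N ‖u - v‖`, and `θ` bounds the squared `L²` error
  -- of `v`.
  have main : ∀ η > 0, ∀ θ > 0, -(η * ∫ t, N t ^ 2 ∂μ) - (1 / (4 * η) + 2 * D) * θ ≤
      sesq (Q a) (x a) (x a) - sesq (Q b) (x b) (x b) +
        2 * ∫ t in a..b, (star (y t) ⬝ᵥ u t).re := by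
    intro η hη θ hθ
    have h2 : ENNReal.ofReal (2 : ℝ) = 2 := by simp
    obtain ⟨v, hvθ, hvL⟩ := MemLp.exists_boundedContinuous_integral_rpow_sub_le (μ := μ) (f := u)
      (p := 2) (by norm_num) (by rwa [h2]) hθ
    rw [h2] at hvL
    have hd : MemLp (fun t => u t - v t) 2 μ := huL.sub hvL
    have hd2 : Integrable (fun t => ‖u t - v t‖ ^ 2) μ := hd.norm.integrable_sq
    have hvθ' : ∫ t, ‖u t - v t‖ ^ 2 ∂μ ≤ θ := by simpa using hvθ
    have htraj := kyp_along_trajectory hT hT' S hQ hQh h ha hb hab hxc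
      (v := v) v.continuous.continuousOn (hg a ha b hb)
      fun s hs t ht => hxg s (hI hs) t (hI ht)
    rw [intervalIntegral.integral_of_le hab] at htraj ⊢
    have hle : ∫ t, (2 * sesq (Q t) (x t) (S.A t *ᵥ x t + S.B t *ᵥ u t) +
          sesq (kypIntegrand S Q t) (Sum.elim (x t) (v t)) (Sum.elim (x t) (v t))) ∂μ ≤
        ∫ t, (2 * (star (y t) ⬝ᵥ u t).re + η * N t ^ 2 +
          (1 / (4 * η) + 2 * D) * ‖u t - v t‖ ^ 2) ∂μ := by
      refine integral_mono_ae ?_ (((hyu.const_mul 2).add (hN2.const_mul η)).add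
        (hd2.const_mul _)) ?_
      · have hMi := locInt_kypIntegrand hT.measurableSet hT' S hQ
        have huI : Set.uIcc a b = Set.Icc a b := Set.uIcc_of_le hab
        refine Integrable.add (Integrable.const_mul ?_ 2) ?_
        · rw [hμ, ← IntegrableOn, ← intervalIntegrable_iff_integrableOn_Ioc_of_le hab]
          refine intervalIntegrable_sesq_right (fun i j => ?_) (by rwa [huI]) (by rwa [huI])
            (hg a ha b hb)
          exact (hQ.aestronglyMeasurable hT.measurableSet i j).mono_measure
            (Measure.restrict_mono (Set.uIoc_subset_uIcc.trans (hT'.uIcc_subset ha hb)) le_rfl)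
        · rw [hμ, ← IntegrableOn, ← intervalIntegrable_iff_integrableOn_Ioc_of_le hab]
          refine intervalIntegrable_sesq_matrix (fun i j => hMi i j a ha b hb) ?_ ?_ <;>
          · rw [huI]
            exact continuousOn_sumElim hxc v.continuous.continuousOn
      · have hout := ae_mono (Measure.restrict_mono hIoc le_rfl) hsol.output_eq
        filter_upwards [hD, hout, ae_restrict_mem measurableSet_Ioc] with t ht1 ht2 ht3
        have htI := Set.Ioc_subset_Icc_self ht3
        have hp := kypIntegrand_perturbation_le S (hQh t (hI htI)) (u t) (v t) (hK t htI)
          (hR t htI) ht1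
        rw [← ht2] at hp
        refine hp.trans ?_
        have hamgm : N t * ‖u t - v t‖ ≤ η * N t ^ 2 + 1 / (4 * η) * ‖u t - v t‖ ^ 2 := by
          have := mul_nonneg hη.le (sq_nonneg (N t - 1 / (2 * η) * ‖u t - v t‖))
          have e : η * (N t - 1 / (2 * η) * ‖u t - v t‖) ^ 2 =
              η * N t ^ 2 + 1 / (4 * η) * ‖u t - v t‖ ^ 2 - N t * ‖u t - v t‖ := by
            field_simp
            ring
          linarith
        show 2 * (star (y t) ⬝ᵥ u t).re + N t * ‖u t - v t‖ + 2 * D * ‖u t - v t‖ ^ 2 ≤ _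
        linarith
    have hsum : Integrable (fun t => 2 * (star (y t) ⬝ᵥ u t).re + η * N t ^ 2) μ :=
      (hyu.const_mul 2).add (hN2.const_mul η)
    rw [integral_add hsum (hd2.const_mul _),
      integral_add (hyu.const_mul 2) (hN2.const_mul η), integral_const_mul, integral_const_mul,
      integral_const_mul] at hle
    have hc : (1 / (4 * η) + 2 * D) * ∫ t, ‖u t - v t‖ ^ 2 ∂μ ≤ (1 / (4 * η) + 2 * D) * θ := by
      gcongr
    linarith
  have hfin : 0 ≤ sesq (Q a) (x a) (x a) - sesq (Q b) (x b) (x b) +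
        2 * ∫ t in a..b, (star (y t) ⬝ᵥ u t).re := by
    refine le_of_forall_pos_sub_le fun ε hε => ?_
    have hN0 : 0 ≤ ∫ t, N t ^ 2 ∂μ := integral_nonneg fun t => sq_nonneg _
    -- First `η` is fixed, with `+ 1` guarding against a zero denominator; then `θ` is chosen in
    -- terms of `η`. Each error is at most `ε / 2`.
    set η := ε / (2 * (∫ t, N t ^ 2 ∂μ + 1)) with hη
    have hη0 : 0 < η := by positivity
    have hc0 : 0 < 1 / (4 * η) + 2 * D := by positivity
    have := main η hη0 (ε / (2 * (1 / (4 * η) + 2 * D))) (by positivity)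
    have e1 : (1 / (4 * η) + 2 * D) * (ε / (2 * (1 / (4 * η) + 2 * D))) = ε / 2 := by
      field_simp
    have e2 : η * ∫ t, N t ^ 2 ∂μ ≤ ε / 2 := by
      have : η * (∫ t, N t ^ 2 ∂μ + 1) = ε / 2 := by rw [hη]; field_simp
      linarith
    linarith
  have hq : ∀ t z, quadFun Q t z = 1 / 2 * sesq (Q t) z z := fun t z => rfl
  simp only [hq]
  linarith

end LTV

theorem theorem5p3 (T : Set ℝ) (hT : IsOpen T) (hT' : T.OrdConnected) (n m : ℕ)
    (S : LTV.System T n m) (Q : ℝ → Matrix (Fin n) (Fin n) ℂ)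
    (hQ : LTV.MatBVLoc T Q) (hQpsd : ∀ t ∈ T, (Q t).PosSemidef) :
    LTV.IsStorageFunction S (LTV.quadFun Q) ↔ LTV.IntegralKYP S Q :=
  ⟨LTV.integralKYP_of_isStorageFunction hT hT' S hQ fun t ht => (hQpsd t ht).isHermitian,
    LTV.isStorageFunction_of_integralKYP hT hT' S hQ hQpsd⟩
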